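/- There is an absolute constant $C>0$ such that the following holds. Let $A\in\mathbb{R}^{n\times n}$ be symmetric, $h\in\mathbb{R}^n$, and let $\pi(x)\propto\exp(\tfrac12 x^TAx+h^Tx)$ be the Ising model on $\{-1,1\}^n$; suppose that for some integer $d\ge 1$ every row of $A$ has at most $d$ nonzero off-diagonal entries. For $i\in[n]$ and $x\in\{-1,1\}^n$ let $\mathsf P_i(x,\cdot)$ be a probability distribution on $\{x,x^{\oplus i}\}$, where $x^{\oplus S}$ is $x$ with the bits in the multiset $S$ flipped with multiplicity. Suppose that the kernels are reversible, $\pi(x)\mathsf P_i(x,x^{\oplus i})=\pi(x^{\oplus i})\mathsf P_i(x^{\oplus i},x)$, and site-consistent: for every $i$ there is a nondecreasing $f_i:(0,\infty)\to[0,1]$ with $\mathsf P_i(x^{i\mapsto -1},x^{i\mapsto +1})=f_i\big(\pi(x^{i\mapsto +1})/\pi(x^{i\mapsto -1})\big)$ for all $x$, where $x^{i\mapsto a}$ is $x$ with the $i$-th value reset to $a$. Let $(X^t)_{0\le t\le T}$ be the continuous-time single-site Markov chain with these kernels and an arbitrary initial law: each site $i$ has an independent rate-one Poisson process of update times, and at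 each update time of site $i$ the kernel $\mathsf P_i$ is applied to the current configuration. Let $\Pi_i'$ be the set of times at which the spin at site $i$ actually changes (its left and right limits differ), and let $\mathcal F_t=\sigma\big(X^0,\Pi_1'\cap[0,t],\dots,\Pi_n'\cap[0,t]\big)$. Let $i\ne j$ be sites, let $\boldsymbol\ell=(\ell_1,\dots,\ell_m)$ be a finite sequence with entries in $\{i,j\}$, and let $\overline{\ell_k}$ be the element of $\{i,j\}$ other than $\ell_k$. Let $t>0$ and $\varepsilon>0$ satisfy $Cm\varepsilon<1$ and $t+m\varepsilon\le T$, let $I_k=[t+(k-1)\varepsilon,\,t+k\varepsilon]$, and let $$\mathcal E^t_{\boldsymbol\ell}=\bigcap_{k=1}^m\Big\{|\Pi'_{\ell_k}\cap I_k|=1,\ |\Pi'_{\overline{\ell_k}}\cap I_k|=0\Big\}.$$ Then, almost surely, $$\Big|\Pr\big(\mathcal E^t_{\boldsymbol\ell}\,\big|\,\mathcal F_t\big)-\varepsilon^m\prod_{k=1}^m\mathsf P_{\ell_k}\big(X^{t,\oplus\ell_1\cdots\ell_{k-1}},X^{t,\oplus\ell_1\cdots\ell_k}\big)\Big|\le C\,m\,d\,\varepsilon^{m+1},$$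 where $X^{t,\oplus\ell_1\cdots\ell_k}$ denotes $(X^t)^{\oplus\{\ell_1,\dots,\ell_k\}}$ (as a multiset). -/

import Mathlib

open MeasureTheory ProbabilityTheory Filter Topology
open scoped NNReal

/-- Configurations `x ∈ {-1,1}^n`. -/
abbrev Config (n : ℕ) : Type := Fin n → ℤˣ

namespace Config

/-- `x^{⊕S}`: the bits in the multiset `S` are flipped with multiplicity. -/
def flip {n : ℕ} (x : Config n) (S : Multiset (Fin n)) : Config n :=
  fun i => (-1) ^ S.count i * x i

/-- `x^{i ↦ a}`: the `i`-th value is reset to `a`. -/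
def reset {n : ℕ} (x : Config n) (i : Fin n) (a : ℤˣ) : Config n :=
  Function.update x i a

/-- A configuration as a real vector. -/
def toReal {n : ℕ} (x : Config n) : Fin n → ℝ :=
  fun i => ((x i : ℤ) : ℝ)

end Config

/-! ### Ising models -/

/-- The unnormalised weight `exp (xᵀ A x / 2 + hᵀ x)`. -/
noncomputable def isingWeight {n : ℕ} (A : Matrix (Fin n) (Fin n) ℝ) (h : Fin n → ℝ)
    (x : Config n) : ℝ :=
  Real.exp (1 / 2 * (x.toReal ⬝ᵥ A.mulVec x.toReal) + h ⬝ᵥ x.toReal)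

/-- The Ising distribution `π_{A,h}`. -/
noncomputable def isingProb {n : ℕ} (A : Matrix (Fin n) (Fin n) ℝ) (h : Fin n → ℝ)
    (x : Config n) : ℝ :=
  isingWeight A h x / ∑ y : Config n, isingWeight A h y

/-- Every site has at most `d` neighbours in the dependence graph of `A`. -/
def DegreeAtMost {n : ℕ} (A : Matrix (Fin n) (Fin n) ℝ) (d : ℕ) : Prop :=
  ∀ i, {k : Fin n | k ≠ i ∧ A i k ≠ 0}.ncard ≤ d

/-! ### Single-site kernels -/

/-- Single-site transition kernels: `P i x ·` is a probability distribution on `{x, x^{⊕ i}}`. -/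
structure IsSiteKernel {n : ℕ} (P : Fin n → Config n → Config n → ℝ) : Prop where
  nonneg : ∀ i x y, 0 ≤ P i x y
  sum_eq_one : ∀ i x, ∑ y, P i x y = 1
  eq_zero : ∀ i x y, y ≠ x → y ≠ x.flip {i} → P i x y = 0

/-- Detailed balance with respect to `π`. -/
def IsReversible {n : ℕ} (π : Config n → ℝ) (P : Fin n → Config n → Config n → ℝ) : Prop :=
  ∀ i x, π x * P i x (x.flip {i}) = P i (x.flip {i}) x * π (x.flip {i})

/-- Site-consistency: the probability of moving site `i` from `-1` to `+1` is a nondecreasing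
function `f_i`, with values in `[0,1]`, of the probability ratio of the move. -/
def IsSiteConsistent {n : ℕ} (π : Config n → ℝ) (P : Fin n → Config n → Config n → ℝ) : Prop :=
  ∀ i, ∃ f : ℝ → ℝ, MonotoneOn f (Set.Ioi 0) ∧ Set.MapsTo f (Set.Ioi 0) (Set.Icc 0 1) ∧
    ∀ x : Config n,
      P i (x.reset i (-1)) (x.reset i 1) = f (π (x.reset i 1) / π (x.reset i (-1)))

/-! ### Continuous-time single-site chains -/

/-- The σ-algebra generated by the random sets `S i ∩ [0,t]`, that is, by the numbers of points
of `S i` in `[0,s]` for `s ≤ t` (used for locally finite `S i`). -/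
@[reducible] noncomputable def pointHistory {n : ℕ} {Ω : Type*} (S : Fin n → Ω → Set ℝ≥0)
    (t : ℝ≥0) : MeasurableSpace Ω :=
  ⨆ i, ⨆ s, ⨆ _ : s ≤ t, MeasurableSpace.comap (fun ω => (S i ω ∩ Set.Icc 0 s).ncard) ⊤

/-- The σ-algebra generated by `X^s`, `s ≤ t`. -/
@[reducible] noncomputable def pathHistory {n : ℕ} {Ω : Type*} (X : ℝ≥0 → Ω → Config n)
    (t : ℝ≥0) : MeasurableSpace Ω :=
  ⨆ s, ⨆ _ : s ≤ t, MeasurableSpace.comap (X s) ⊤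

/-- The full filtration `𝒢_t`, generated by the path and the update times up to time `t`. -/
@[reducible] noncomputable def fullHistory {n : ℕ} {Ω : Type*} (X : ℝ≥0 → Ω → Config n)
    (U : Fin n → Ω → Set ℝ≥0) (t : ℝ≥0) : MeasurableSpace Ω :=
  pathHistory X t ⊔ pointHistory U t

/-- `(X^t)_{0 ≤ t ≤ T}` is a single-site Markov chain with kernels `P`, driven by the random sets
of update times `U i`: the `U i` are independent Poisson point processes of rate one (with respect
to the full filtration), a site can change only at one of its update times, and at an update time
of site `i` the kernel `P i` is applied. The law of `X^0` is arbitrary. -/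
structure IsSingleSiteChain {n : ℕ} {Ω : Type*} [MeasurableSpace Ω] (μ : Measure Ω)
    (P : Fin n → Config n → Config n → ℝ) (T : ℝ≥0)
    (X : ℝ≥0 → Ω → Config n) (U : Fin n → Ω → Set ℝ≥0) : Prop where
  measurable_path : ∀ t ≤ T, ∀ x : Config n, MeasurableSet (X t ⁻¹' {x})
  zero_notMem : ∀ i ω, 0 ∉ U i ω
  finite : ∀ i ω, (U i ω ∩ Set.Icc 0 T).Finite
  measurable_count : ∀ i, ∀ t ≤ T, Measurable fun ω => (U i ω ∩ Set.Icc 0 t).ncard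
  /-- the number of updates of a site in `(s,t]` is Poisson with mean `t - s` -/
  law_count : ∀ i s t, s ≤ t → t ≤ T →
    μ.map (fun ω => (U i ω ∩ Set.Ioc s t).ncard) = poissonMeasure (t - s)
  /-- the updates of different sites are independent -/
  indep_sites : ∀ s t, s ≤ t → t ≤ T →
    iIndepFun (fun i ω => (U i ω ∩ Set.Ioc s t).ncard) μ
  /-- the updates after time `s` are independent of the past -/
  indep_past : ∀ s t, s ≤ t → t ≤ T →
    Indep (⨆ i, MeasurableSpace.comap (fun ω => (U i ω ∩ Set.Ioc s t).ncard) ⊤)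
      (fullHistory X U s) μ
  /-- site `i` changes only at update times of site `i` -/
  eq_of_no_update : ∀ ω i s t, s ≤ t → t ≤ T → U i ω ∩ Set.Ioc s t = ∅ → X t ω i = X s ω i
  /-- given the path up to time `s` and the update times up to time `t`, if the only update in
  `(s,t]` is one of site `i`, then `X^t` has law `P i (X^s) ·` -/
  update : ∀ i s t, s ≤ t → t ≤ T → ∀ y : Config n, ∀ᵐ ω ∂μ,
    (U i ω ∩ Set.Ioc s t).ncard = 1 → (∀ k, k ≠ i → U k ω ∩ Set.Ioc s t = ∅) →
      (μ⟦X t ⁻¹' {y} | pathHistory X s ⊔ pointHistory U t⟧) ω = P i (X s ω) y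

/-! ### Observed flips -/

/-- `Π'_i`: the times at which the left limit of the spin at site `i` differs from its value. -/
def flipTimes {n : ℕ} {Ω : Type*} (X : ℝ≥0 → Ω → Config n) (i : Fin n) (ω : Ω) : Set ℝ≥0 :=
  {s | 0 < s ∧ ∀ᶠ r in 𝓝[<] s, X r ω i ≠ X s ω i}

/-- The observation filtration `ℱ_t = σ(X^0, Π'_1(t), …, Π'_n(t))`. -/
@[reducible] noncomputable def obsHistory {n : ℕ} {Ω : Type*} (X : ℝ≥0 → Ω → Config n)
    (t : ℝ≥0) : MeasurableSpace Ω :=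
  MeasurableSpace.comap (X 0) ⊤ ⊔ pointHistory (flipTimes X) t

/-- The event `ℰ^t_ℓ`: in the `k`-th of the consecutive windows of length `ε` after time `t`, the
site `ℓ_k` flips exactly once and the other site of the pair `i, j` does not flip. -/
def flipEvent {n : ℕ} {Ω : Type*} (X : ℝ≥0 → Ω → Config n) (i j : Fin n) (l : List (Fin n))
    (ε t : ℝ≥0) : Set Ω :=
  {ω | ∀ k : Fin l.length,
    (flipTimes X l[k] ω ∩ Set.Icc (t + (k : ℕ) * ε) (t + ((k : ℕ) + 1) * ε)).encard = 1 ∧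
    (flipTimes X (if l[k] = i then j else i) ω ∩
      Set.Icc (t + (k : ℕ) * ε) (t + ((k : ℕ) + 1) * ε)).encard = 0}

/-- `∏_k P_{ℓ_k}(x^{⊕ ℓ_1 … ℓ_{k-1}}, x^{⊕ ℓ_1 … ℓ_k})`. -/
def transitionProd {n : ℕ} (P : Fin n → Config n → Config n → ℝ) (l : List (Fin n))
    (x : Config n) : ℝ :=
  ∏ k : Fin l.length, P l[k] (x.flip (l.take (k : ℕ))) (x.flip (l.take ((k : ℕ) + 1)))

/-! Let `S` consist of `i`, `j` and their neighbours, so `S.card ≤ 2 + 2 * d`. The Ising ratio at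
`i` or `j` involves only spins in `S`; site-consistency gives the upward flip probability as a
function of this ratio, and detailed balance gives the downward one (`kernel_flip_congr`). Sites
outside `S` may therefore be updated freely without affecting the flip probabilities in question,
which is why the error depends on `d` and not on `n`.

In a window of length `ε`, call it good if the only update in `S` is one of the prescribed site.
This has probability `c = ε * exp (-(S.card * ε))` independently of the past, and on it the required
flip has exactly the kernel probability (`measureReal_flip_of_soleUpdate`). A bad window can still
show the required flip, but only if the prescribed site is updated, so good and bad windows together
cost at most `q = 1 - exp (-ε) ≤ ε`. Induction over the windows
(`measureReal_inter_flipEvent_mem_Icc`) places the conditional probability between `c ^ m * ϖ` and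
`c ^ m * ϖ + (q ^ m - c ^ m)`, with `ϖ` the product of kernels. Both ends are within `ε ^ m - c ^ m
≤ S.card * m * ε ^ (m + 1)` of `ε ^ m * ϖ` (`pow_sub_pow_le`).

The delicate point is that the chain specifies the law of an update only when no other site at all
is updated in the interval. A window is cut into `M + 1` pieces: except with probability of order `n
/ M`, the prescribed update is alone in its piece, and `M` tends to infinity.

The estimates hold on every event of the full past. The observed history is contained in that past
and determines `X t`, so the estimates on its level sets yield the conditional probability
(`abs_condExp_indicator_sub_le`). -/

/-! ### Equipartitions of an interval -/

/-- The `r`-th point of the partition of `[a, b]` into `M + 1` equal pieces. -/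
noncomputable def partitionPoint (a b : ℝ≥0) (M r : ℕ) : ℝ≥0 := a + (b - a) * (r / (M + 1))

lemma partitionPoint_zero (a b : ℝ≥0) (M : ℕ) : partitionPoint a b M 0 = a := by
  simp [partitionPoint]

lemma partitionPoint_last {a b : ℝ≥0} (hab : a ≤ b) (M : ℕ) :
    partitionPoint a b M (M + 1) = b := by
  simp [partitionPoint, hab]

lemma partitionPoint_mono (a b : ℝ≥0) (M : ℕ) : Monotone (partitionPoint a b M) := by
  intro r r' hr
  unfold partitionPoint
  gcongr

lemma partitionPoint_succ (a b : ℝ≥0) (M r : ℕ) :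
    partitionPoint a b M (r + 1) = partitionPoint a b M r + (b - a) / (M + 1) := by
  unfold partitionPoint
  push_cast
  ring

lemma partitionPoint_le {a b : ℝ≥0} (hab : a ≤ b) {M r : ℕ} (hr : r ≤ M + 1) :
    partitionPoint a b M r ≤ b :=
  (partitionPoint_mono a b M hr).trans (partitionPoint_last hab M).le

lemma le_partitionPoint (a b : ℝ≥0) (M r : ℕ) : a ≤ partitionPoint a b M r :=
  le_self_add

lemma ncard_inter_Ioc_add {V : Set ℝ≥0} {a b c : ℝ≥0} (hV : (V ∩ Set.Ioc a c).Finite)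
    (hab : a ≤ b) (hbc : b ≤ c) :
    (V ∩ Set.Ioc a c).ncard = (V ∩ Set.Ioc a b).ncard + (V ∩ Set.Ioc b c).ncard := by
  rw [← Set.Ioc_union_Ioc_eq_Ioc hab hbc, Set.inter_union_distrib_left] at hV ⊢
  refine Set.ncard_union_eq ?_ (hV.subset Set.subset_union_left)
    (hV.subset Set.subset_union_right)
  exact (Set.Ioc_disjoint_Ioc_of_le le_rfl).mono Set.inter_subset_right Set.inter_subset_right

lemma ncard_inter_Ioc_eq_sum {V : Set ℝ≥0} {a b : ℝ≥0} (hab : a ≤ b)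
    (hV : (V ∩ Set.Ioc a b).Finite) (M : ℕ) :
    (V ∩ Set.Ioc a b).ncard = ∑ r ∈ Finset.range (M + 1),
      (V ∩ Set.Ioc (partitionPoint a b M r) (partitionPoint a b M (r + 1))).ncard := by
  have key : ∀ k ≤ M + 1, (V ∩ Set.Ioc a (partitionPoint a b M k)).ncard =
      ∑ r ∈ Finset.range k,
        (V ∩ Set.Ioc (partitionPoint a b M r) (partitionPoint a b M (r + 1))).ncard := by
    intro k
    induction k with
    | zero => simp [partitionPoint_zero]
    | succ k ih =>
      intro hk
      rw [Finset.sum_range_succ, ← ih (by omega)]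
      refine ncard_inter_Ioc_add (hV.subset ?_) (le_partitionPoint _ _ _ _)
        (partitionPoint_mono _ _ _ (Nat.le_succ k))
      gcongr
      exact partitionPoint_le hab hk
  rw [← key (M + 1) le_rfl, partitionPoint_last hab]

/-- The mesh eventually falls below the smallest gap between two points of a finite set. -/
lemma eventually_ncard_partition_le_one {V : Set ℝ≥0} {a b : ℝ≥0} (hab : a ≤ b)
    (hV : (V ∩ Set.Ioc a b).Finite) :
    ∀ᶠ M : ℕ in atTop, ∀ r < M + 1,
      (V ∩ Set.Ioc (partitionPoint a b M r) (partitionPoint a b M (r + 1))).ncard ≤ 1 := by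
  have hlim : Tendsto (fun M : ℕ => ((b - a : ℝ≥0) : ℝ) / ((M : ℝ) + 1)) atTop (𝓝 0) :=
    tendsto_const_nhds.div_atTop (tendsto_natCast_atTop_atTop.atTop_add tendsto_const_nhds)
  have h : ∀ᶠ M : ℕ in atTop, ∀ x ∈ V ∩ Set.Ioc a b, ∀ y ∈ V ∩ Set.Ioc a b, x < y →
      ((b - a : ℝ≥0) : ℝ) / ((M : ℝ) + 1) < (y : ℝ) - x := by
    refine (eventually_all_finite hV).2 fun x _ => (eventually_all_finite hV).2 fun y _ => ?_
    by_cases hxy : x < y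
    · filter_upwards [hlim.eventually_lt_const (sub_pos.2 (NNReal.coe_lt_coe.2 hxy))] with M hM _
      exact hM
    · exact Eventually.of_forall fun M h => absurd h hxy
  filter_upwards [h] with M hM r hr
  have hsub : V ∩ Set.Ioc (partitionPoint a b M r) (partitionPoint a b M (r + 1)) ⊆
      V ∩ Set.Ioc a b := by
    gcongr
    · exact le_partitionPoint _ _ _ _
    · exact partitionPoint_le hab hr
  have hlt : ∀ x ∈ V ∩ Set.Ioc (partitionPoint a b M r) (partitionPoint a b M (r + 1)),
      ∀ y ∈ V ∩ Set.Ioc (partitionPoint a b M r) (partitionPoint a b M (r + 1)), ¬ x < y := by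
    intro x hx y hy hxy
    have h1 := hM x (hsub hx) y (hsub hy) hxy
    have h2 := NNReal.coe_lt_coe.2 hx.2.1
    have h3 := NNReal.coe_le_coe.2 hy.2.2
    rw [partitionPoint_succ] at h3
    push_cast at h3
    linarith
  refine (Set.ncard_le_one (hV.subset hsub)).2 fun x hx y hy => ?_
  exact le_antisymm (not_lt.1 (hlt y hy x hx)) (not_lt.1 (hlt x hx y hy))

/-! ### Paths of a single-site chain -/

namespace IsSingleSiteChain

variable {n : ℕ} {Ω : Type*} [MeasurableSpace Ω] {μ : Measure Ω}
  {P : Fin n → Config n → Config n → ℝ} {T : ℝ≥0}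
  {X : ℝ≥0 → Ω → Config n} {U : Fin n → Ω → Set ℝ≥0}

lemma finite_Ioc (hX : IsSingleSiteChain μ P T X U) (i : Fin n) (ω : Ω) (s : ℝ≥0) {t : ℝ≥0}
    (ht : t ≤ T) : (U i ω ∩ Set.Ioc s t).Finite :=
  (hX.finite i ω).subset fun _ hx => ⟨hx.1, zero_le, hx.2.2.trans ht⟩

lemma exists_lt_no_update (hX : IsSingleSiteChain μ P T X U) (i : Fin n) (ω : Ω) {t : ℝ≥0}
    (ht0 : 0 < t) (ht : t ≤ T) : ∃ s < t, U i ω ∩ Set.Ioo s t = ∅ := by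
  have hfin : (U i ω ∩ Set.Ioo 0 t).Finite :=
    (hX.finite_Ioc i ω 0 ht).subset (by gcongr; exact Set.Ioo_subset_Ioc_self)
  have h : ∀ᶠ s in 𝓝[<] t, ∀ x ∈ U i ω ∩ Set.Ioo 0 t, x < s :=
    (eventually_all_finite hfin).2 fun x hx => (eventually_gt_nhds hx.2.2).filter_mono
      nhdsWithin_le_nhds
  have : (𝓝[<] t).NeBot := nhdsLT_neBot_of_exists_lt ⟨0, ht0⟩
  obtain ⟨s, hs, hst⟩ := (h.and self_mem_nhdsWithin).exists
  refine ⟨s, hst, Set.eq_empty_iff_forall_notMem.2 fun x hx => ?_⟩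
  exact (hs x ⟨hx.1, pos_of_gt hx.2.1, hx.2.2⟩).not_gt hx.2.1

/-- Updates are locally finite, so without an update at `t` the spin is constant on some interval
`(s, t]`, and its left limit equals its value. -/
lemma mem_of_mem_flipTimes (hX : IsSingleSiteChain μ P T X U) {i : Fin n} {ω : Ω} {t : ℝ≥0}
    (ht : t ≤ T) (hmem : t ∈ flipTimes X i ω) : t ∈ U i ω := by
  by_contra hU
  obtain ⟨ht0, hev⟩ := hmem
  obtain ⟨s, hst, hs⟩ := hX.exists_lt_no_update i ω ht0 ht
  have : (𝓝[<] t).NeBot := nhdsLT_neBot_of_exists_lt ⟨0, ht0⟩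
  obtain ⟨r, hr, hsr⟩ := (hev.and (Ioo_mem_nhdsLT hst)).exists
  refine hr (hX.eq_of_no_update ω i r t hsr.2.le ht ?_).symm
  refine Set.eq_empty_iff_forall_notMem.2 fun x hx => ?_
  rcases hx.2.2.eq_or_lt with rfl | hxt
  · exact hU hx.1
  · exact Set.eq_empty_iff_forall_notMem.1 hs x ⟨hx.1, hsr.1.trans hx.2.1, hxt⟩

lemma finite_flipTimes (hX : IsSingleSiteChain μ P T X U) (i : Fin n) (ω : Ω) {I : Set ℝ≥0}
    (hI : I ⊆ Set.Iic T) : (flipTimes X i ω ∩ I).Finite :=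
  (hX.finite i ω).subset fun _ hx => ⟨hX.mem_of_mem_flipTimes (hI hx.2) hx.1, zero_le, hI hx.2⟩

lemma flipTimes_Ioc_of_no_update (hX : IsSingleSiteChain μ P T X U) {i : Fin n} {ω : Ω}
    {u v : ℝ≥0} (hv : v ≤ T) (h : U i ω ∩ Set.Ioc u v = ∅) :
    flipTimes X i ω ∩ Set.Ioc u v = ∅ := by
  refine Set.eq_empty_iff_forall_notMem.2 fun x hx => Set.eq_empty_iff_forall_notMem.1 h x
    ⟨hX.mem_of_mem_flipTimes (hx.2.2.trans hv) hx.1, hx.2⟩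

/-- If site `i` is updated at most once in `(u, v]`, then it flips there exactly when its spin
differs at `u` and at `v`. -/
lemma ncard_flipTimes_of_le_one (hX : IsSingleSiteChain μ P T X U) {i : Fin n} {ω : Ω}
    {u v : ℝ≥0} (huv : u ≤ v) (hv : v ≤ T) (h : (U i ω ∩ Set.Ioc u v).ncard ≤ 1) :
    (flipTimes X i ω ∩ Set.Ioc u v).ncard = if X v ω i = X u ω i then 0 else 1 := by
  rcases (U i ω ∩ Set.Ioc u v).eq_empty_or_nonempty with h0 | ⟨w, hw⟩
  · rw [hX.flipTimes_Ioc_of_no_update hv h0, if_pos (hX.eq_of_no_update ω i u v huv hv h0)]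
    simp
  have huniq : ∀ x ∈ U i ω ∩ Set.Ioc u v, x = w := fun x hx =>
    (Set.ncard_le_one (hX.finite_Ioc i ω u hv)).1 h x hx w hw
  have hvw : X v ω i = X w ω i := by
    refine hX.eq_of_no_update ω i w v hw.2.2 hv (Set.eq_empty_iff_forall_notMem.2 fun x hx => ?_)
    exact hx.2.1.ne' (huniq x ⟨hx.1, hw.2.1.trans hx.2.1, hx.2.2⟩)
  have hru : ∀ r, u ≤ r → r < w → X r ω i = X u ω i := by
    intro r hur hrw
    refine hX.eq_of_no_update ω i u r hur ((hrw.le.trans hw.2.2).trans hv)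
      (Set.eq_empty_iff_forall_notMem.2 fun x hx => ?_)
    exact (hx.2.2.trans_lt hrw).ne (huniq x ⟨hx.1, hx.2.1, (hx.2.2.trans hrw.le).trans hw.2.2⟩)
  -- The left limit at the unique update `w` is the spin at `u`, and the value at `w` is the spin at
  -- `v`; comparing them decides whether `w` is a flip.
  have hev : ∀ᶠ r in 𝓝[<] w, X r ω i = X u ω i := by
    filter_upwards [Ioo_mem_nhdsLT hw.2.1] with r hr using hru r hr.1.le hr.2
  have hsub : flipTimes X i ω ∩ Set.Ioc u v ⊆ {w} := fun x hx =>
    huniq x ⟨hX.mem_of_mem_flipTimes (hx.2.2.trans hv) hx.1, hx.2⟩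
  split_ifs with heq
  · rw [Set.ncard_eq_zero ((Set.finite_singleton w).subset hsub)]
    refine Set.eq_empty_iff_forall_notMem.2 fun x hx => ?_
    obtain rfl := hsub hx
    have : (𝓝[<] x).NeBot := nhdsLT_neBot_of_exists_lt ⟨0, hx.1.1⟩
    obtain ⟨r, h1, h2⟩ := (hev.and hx.1.2).exists
    exact h2 (by rw [h1, ← heq, hvw])
  · rw [Set.ncard_eq_one]
    refine ⟨w, hsub.antisymm ?_⟩
    rintro x rfl
    refine ⟨⟨pos_of_gt hw.2.1, ?_⟩, hw.2⟩
    filter_upwards [hev] with r hr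
    rw [hr, ← hvw]
    exact Ne.symm heq

lemma eventually_ncard_flipTimes_eq_sum (hX : IsSingleSiteChain μ P T X U) (i : Fin n) (ω : Ω)
    {u v : ℝ≥0} (huv : u ≤ v) (hv : v ≤ T) :
    ∀ᶠ M : ℕ in atTop, (flipTimes X i ω ∩ Set.Ioc u v).ncard = ∑ r ∈ Finset.range (M + 1),
      if X (partitionPoint u v M (r + 1)) ω i = X (partitionPoint u v M r) ω i then 0 else 1 := by
  filter_upwards [eventually_ncard_partition_le_one huv (hX.finite_Ioc i ω u hv)] with M hM
  rw [ncard_inter_Ioc_eq_sum huv (hX.finite_flipTimes i ω fun x hx => hx.2.trans hv) M]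
  refine Finset.sum_congr rfl fun r hr => ?_
  have hr' := Finset.mem_range.1 hr
  exact hX.ncard_flipTimes_of_le_one (partitionPoint_mono _ _ _ (Nat.le_succ r))
    ((partitionPoint_le huv hr').trans hv) (hM r hr')

/-- The spin at time `v` is the spin at time `u` times the parity of the flips in `(u, v]`. -/
lemma spin_eq (hX : IsSingleSiteChain μ P T X U) (i : Fin n) (ω : Ω)
    {u v : ℝ≥0} (huv : u ≤ v) (hv : v ≤ T) :
    X v ω i = (-1) ^ (flipTimes X i ω ∩ Set.Ioc u v).ncard * X u ω i := by
  obtain ⟨M, hM⟩ := (hX.eventually_ncard_flipTimes_eq_sum i ω huv hv).exists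
  have key : ∀ k, X (partitionPoint u v M k) ω i = (-1) ^ (∑ r ∈ Finset.range k,
      if X (partitionPoint u v M (r + 1)) ω i = X (partitionPoint u v M r) ω i then 0 else 1) *
      X u ω i := by
    intro k
    induction k with
    | zero => simp [partitionPoint_zero]
    | succ k ih =>
      rw [Finset.sum_range_succ, pow_add, mul_right_comm, ← ih]
      split_ifs with h
      · simpa using h
      · rw [pow_one, mul_neg_one]
        exact Int.units_ne_iff_eq_neg.1 h
  rw [hM, ← key (M + 1), partitionPoint_last huv]

end IsSingleSiteChain

/-! ### Measurability of the histories -/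

lemma measurable_path {n : ℕ} {Ω : Type*} (X : ℝ≥0 → Ω → Config n) {s t : ℝ≥0} (hst : s ≤ t) :
    Measurable[pathHistory X t, ⊤] (X s) :=
  measurable_iff_comap_le.2 (le_iSup₂_of_le s hst le_rfl)

lemma measurable_pointHistory {n : ℕ} {Ω : Type*} (S : Fin n → Ω → Set ℝ≥0) (i : Fin n)
    {s t : ℝ≥0} (hst : s ≤ t) :
    Measurable[pointHistory S t] fun ω => (S i ω ∩ Set.Icc 0 s).ncard :=
  measurable_iff_comap_le.2 (le_iSup_of_le i (le_iSup₂_of_le s hst le_rfl))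

lemma pathHistory_mono {n : ℕ} {Ω : Type*} (X : ℝ≥0 → Ω → Config n) {s t : ℝ≥0} (hst : s ≤ t) :
    pathHistory X s ≤ pathHistory X t :=
  iSup₂_le fun r hr => le_iSup₂_of_le r (hr.trans hst) le_rfl

lemma pointHistory_mono {n : ℕ} {Ω : Type*} (S : Fin n → Ω → Set ℝ≥0) {s t : ℝ≥0}
    (hst : s ≤ t) : pointHistory S s ≤ pointHistory S t :=
  iSup_mono fun _ => iSup₂_le fun r hr => le_iSup₂_of_le r (hr.trans hst) le_rfl

lemma fullHistory_mono {n : ℕ} {Ω : Type*} (X : ℝ≥0 → Ω → Config n) (U : Fin n → Ω → Set ℝ≥0)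
    {s t : ℝ≥0} (hst : s ≤ t) : fullHistory X U s ≤ fullHistory X U t :=
  sup_le_sup (pathHistory_mono X hst) (pointHistory_mono U hst)

lemma measurableSet_spin {n : ℕ} {Ω : Type*} (X : ℝ≥0 → Ω → Config n) {s t : ℝ≥0} (hst : s ≤ t)
    (p : Config n → Prop) : MeasurableSet[pathHistory X t] {ω | p (X s ω)} :=
  measurable_path X hst (MeasurableSpace.measurableSet_top (s := {x | p x}))

lemma measurableSet_spin_eq {n : ℕ} {Ω : Type*} (X : ℝ≥0 → Ω → Config n) {r s t : ℝ≥0}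
    (hrt : r ≤ t) (hst : s ≤ t) (i : Fin n) :
    MeasurableSet[pathHistory X t] {ω | X r ω i = X s ω i} := by
  have : {ω | X r ω i = X s ω i} = ⋃ x : Config n, {ω | X r ω = x} ∩ {ω | x i = X s ω i} := by
    ext ω
    simp
  rw [this]
  exact MeasurableSet.iUnion fun x => (measurableSet_spin X hrt (· = x)).inter
    (measurableSet_spin X hst fun y => x i = y i)

namespace IsSingleSiteChain

variable {n : ℕ} {Ω : Type*} [mΩ : MeasurableSpace Ω] {μ : Measure Ω}
  {P : Fin n → Config n → Config n → ℝ} {T : ℝ≥0}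
  {X : ℝ≥0 → Ω → Config n} {U : Fin n → Ω → Set ℝ≥0}

lemma pathHistory_le (hX : IsSingleSiteChain μ P T X U) {t : ℝ≥0} (ht : t ≤ T) :
    pathHistory X t ≤ mΩ := by
  refine iSup₂_le fun s hs => ?_
  rintro _ ⟨A, -, rfl⟩
  rw [← Set.biUnion_preimage_singleton]
  exact MeasurableSet.biUnion A.to_countable fun x _ => hX.measurable_path s (hs.trans ht) x

lemma pointHistory_le (hX : IsSingleSiteChain μ P T X U) {t : ℝ≥0} (ht : t ≤ T) :
    pointHistory U t ≤ mΩ :=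
  iSup_le fun i => iSup₂_le fun s hs => measurable_iff_comap_le.1
    (hX.measurable_count i s (hs.trans ht))

lemma fullHistory_le (hX : IsSingleSiteChain μ P T X U) {t : ℝ≥0} (ht : t ≤ T) :
    fullHistory X U t ≤ mΩ :=
  sup_le (hX.pathHistory_le ht) (hX.pointHistory_le ht)

lemma measurable_updates (hX : IsSingleSiteChain μ P T X U) (i : Fin n) {s t r : ℝ≥0}
    (hst : s ≤ t) (htr : t ≤ r) (hrT : r ≤ T) :
    Measurable[pointHistory U r] fun ω => (U i ω ∩ Set.Ioc s t).ncard := by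
  have hIcc : ∀ ω (u : ℝ≥0), U i ω ∩ Set.Icc 0 u = U i ω ∩ Set.Ioc 0 u := by
    intro ω u
    ext x
    refine ⟨fun hx => ⟨hx.1, pos_iff_ne_zero.2 ?_, hx.2.2⟩, fun hx => ⟨hx.1, hx.2.1.le, hx.2.2⟩⟩
    rintro rfl
    exact hX.zero_notMem i ω hx.1
  have h : (fun ω => (U i ω ∩ Set.Ioc s t).ncard) = fun ω =>
      (U i ω ∩ Set.Icc 0 t).ncard - (U i ω ∩ Set.Icc 0 s).ncard := by
    funext ω
    rw [hIcc, hIcc, ncard_inter_Ioc_add (hX.finite_Ioc i ω 0 (htr.trans hrT)) zero_le hst,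
      Nat.add_sub_cancel_left]
  rw [h]
  exact (measurable_pointHistory U i htr).sub (measurable_pointHistory U i (hst.trans htr))

/-- Flips are defined through left limits, but their number is the pointwise limit of the number of
spin changes along finer and finer partitions, each a function of finitely many spins. -/
lemma measurable_ncard_flipTimes (hX : IsSingleSiteChain μ P T X U) (i : Fin n) {u v t : ℝ≥0}
    (huv : u ≤ v) (hvt : v ≤ t) (htT : t ≤ T) :
    Measurable[pathHistory X t] fun ω => (flipTimes X i ω ∩ Set.Ioc u v).ncard := by
  refine @measurable_of_tendsto_metrizable Ω ℕ (pathHistory X t) _ _ _ _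
    (fun M ω => ∑ r ∈ Finset.range (M + 1), if X (partitionPoint u v M (r + 1)) ω i =
      X (partitionPoint u v M r) ω i then 0 else 1) _ (fun M => ?_) (tendsto_pi_nhds.2 fun ω => ?_)
  · refine Finset.measurable_fun_sum _ fun r hr => ?_
    have hr' := Finset.mem_range.1 hr
    exact Measurable.ite (measurableSet_spin_eq X ((partitionPoint_le huv hr').trans hvt)
      ((partitionPoint_le huv hr'.le).trans hvt) i) measurable_const measurable_const
  · refine tendsto_const_nhds.congr' ?_
    exact hX.eventually_ncard_flipTimes_eq_sum i ω huv (hvt.trans htT)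

lemma measurableSet_mem_flipTimes (hX : IsSingleSiteChain μ P T X U) (i : Fin n) {t : ℝ≥0}
    (ht : t ≤ T) : MeasurableSet[pathHistory X t] {ω | t ∈ flipTimes X i ω} := by
  rcases eq_zero_or_pos t with rfl | ht0
  · simp [flipTimes]
  obtain ⟨a, -, ha, hlim⟩ := exists_seq_strictMono_tendsto' ht0
  have hlim' : Tendsto a atTop (𝓝[<] t) :=
    tendsto_nhdsWithin_iff.2 ⟨hlim, Eventually.of_forall fun k => (ha k).2⟩
  -- The spin is constant just before `t`, so its left limit can be tested along one fixed sequence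
  -- increasing to `t`.
  have h : {ω | t ∈ flipTimes X i ω} =
      ⋃ N : ℕ, ⋂ k : ℕ, ⋂ _ : N ≤ k, {ω | X (a k) ω i = X t ω i}ᶜ := by
    ext ω
    simp only [Set.mem_ofPred_eq, Set.mem_iUnion, Set.mem_iInter, Set.mem_compl_iff]
    refine ⟨fun hω => eventually_atTop.1 (hlim'.eventually hω.2), fun hω => ⟨ht0, ?_⟩⟩
    obtain ⟨s, hst, hs⟩ := hX.exists_lt_no_update i ω ht0 ht
    obtain ⟨k, hk1, hk2⟩ := ((eventually_atTop.2 hω).and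
      (hlim.eventually (lt_mem_nhds hst))).exists
    have hconst : ∀ r r', s < r → r ≤ r' → r' < t → X r' ω i = X r ω i := by
      intro r r' hsr hrr' hr't
      refine hX.eq_of_no_update ω i r r' hrr' (hr't.le.trans ht)
        (Set.eq_empty_iff_forall_notMem.2 fun x hx => ?_)
      exact Set.eq_empty_iff_forall_notMem.1 hs x
        ⟨hx.1, hsr.trans hx.2.1, hx.2.2.trans_lt hr't⟩
    filter_upwards [Ioo_mem_nhdsLT (ha k).2] with r hr
    rw [hconst (a k) r hk2 hr.1.le hr.2]
    exact hk1
  rw [h]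
  exact MeasurableSet.iUnion fun N => MeasurableSet.iInter fun k => MeasurableSet.iInter fun _ =>
    (measurableSet_spin_eq X (ha k).2.le le_rfl i).compl

lemma obsHistory_le_pathHistory (hX : IsSingleSiteChain μ P T X U) {t : ℝ≥0} (ht : t ≤ T) :
    obsHistory X t ≤ pathHistory X t := by
  refine sup_le (le_iSup₂_of_le 0 zero_le le_rfl) ?_
  refine iSup_le fun i => iSup₂_le fun s hs => measurable_iff_comap_le.1 ?_
  have h : (fun ω => (flipTimes X i ω ∩ Set.Icc 0 s).ncard) =
      fun ω => (flipTimes X i ω ∩ Set.Ioc 0 s).ncard := by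
    funext ω
    congr 1
    ext x
    exact ⟨fun hx => ⟨hx.1, hx.1.1, hx.2.2⟩, fun hx => ⟨hx.1, hx.2.1.le, hx.2.2⟩⟩
  rw [h]
  exact hX.measurable_ncard_flipTimes i zero_le hs ht

lemma obsHistory_le (hX : IsSingleSiteChain μ P T X U) {t : ℝ≥0} (ht : t ≤ T) :
    obsHistory X t ≤ mΩ :=
  (hX.obsHistory_le_pathHistory ht).trans (hX.pathHistory_le ht)

/-- The initial configuration and the flips up to time `t` determine the configuration at `t`. -/
lemma measurable_obsHistory (hX : IsSingleSiteChain μ P T X U) {t : ℝ≥0} (ht : t ≤ T) :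
    Measurable[obsHistory X t, ⊤] (X t) := by
  have hcount : ∀ i, Measurable[obsHistory X t, ⊤]
      fun ω => (flipTimes X i ω ∩ Set.Icc 0 t).ncard := fun i =>
    (measurable_pointHistory (flipTimes X) i le_rfl).mono le_sup_right le_rfl
  have h0 : Measurable[obsHistory X t, ⊤] (X 0) :=
    measurable_iff_comap_le.2 le_sup_left
  have hsite : ∀ i (a : ℤˣ), MeasurableSet[obsHistory X t] {ω | X t ω i = a} := by
    intro i a
    -- By `spin_eq`, the parity of the number of flips and the initial spin give the current spin.
    have h : {ω | X t ω i = a} = ⋃ k : ℕ, (fun ω => (flipTimes X i ω ∩ Set.Icc 0 t).ncard) ⁻¹' {k} ∩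
        X 0 ⁻¹' {x | (-1) ^ k * x i = a} := by
      ext ω
      have hI : flipTimes X i ω ∩ Set.Icc 0 t = flipTimes X i ω ∩ Set.Ioc 0 t := by
        ext x
        exact ⟨fun hx => ⟨hx.1, hx.1.1, hx.2.2⟩, fun hx => ⟨hx.1, hx.2.1.le, hx.2.2⟩⟩
      simp [hX.spin_eq i ω zero_le ht, hI]
    rw [h]
    exact MeasurableSet.iUnion fun k => (hcount i MeasurableSpace.measurableSet_top).inter
      (h0 MeasurableSpace.measurableSet_top)
  intro A _
  rw [← Set.biUnion_preimage_singleton]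
  refine MeasurableSet.biUnion A.to_countable fun x _ => ?_
  have h : X t ⁻¹' {x} = ⋂ i, {ω | X t ω i = x i} := by
    ext ω
    simp [funext_iff]
  rw [h]
  exact MeasurableSet.iInter fun i => hsite i (x i)

/-- The windows of `flipEvent` are closed while updates are counted on half-open intervals. A flip
at the left endpoint is only almost surely absent, so it is recorded separately in order to get
genuine measurability. -/
lemma encard_flipTimes_Icc (hX : IsSingleSiteChain μ P T X U) (i : Fin n) (ω : Ω) {a b : ℝ≥0}
    (hab : a ≤ b) (hb : b ≤ T) [Decidable (a ∈ flipTimes X i ω)] :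
    (flipTimes X i ω ∩ Set.Icc a b).encard =
      ((flipTimes X i ω ∩ Set.Ioc a b).ncard + if a ∈ flipTimes X i ω then 1 else 0 : ℕ) := by
  have hfin := hX.finite_flipTimes i ω (I := Set.Ioc a b) fun x hx => hx.2.trans hb
  rw [← Set.Ioc_insert_left hab]
  split_ifs with h
  · rw [Set.inter_insert_of_mem h, Set.encard_insert_of_notMem (by simp), ← hfin.cast_ncard_eq]
    simp
  · rw [Set.inter_insert_of_notMem h, ← hfin.cast_ncard_eq, add_zero]

lemma measurableSet_encard_flipTimes (hX : IsSingleSiteChain μ P T X U) (i : Fin n) {a b : ℝ≥0}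
    (hab : a ≤ b) (hb : b ≤ T) (k : ℕ) :
    MeasurableSet {ω | (flipTimes X i ω ∩ Set.Icc a b).encard = k} := by
  classical
  have h : {ω | (flipTimes X i ω ∩ Set.Icc a b).encard = k} = {ω |
      ((flipTimes X i ω ∩ Set.Ioc a b).ncard + if a ∈ flipTimes X i ω then 1 else 0) = k} := by
    ext ω
    simp only [Set.mem_ofPred_eq, hX.encard_flipTimes_Icc i ω hab hb, Nat.cast_inj]
  rw [h]
  have h1 : Measurable fun ω => (flipTimes X i ω ∩ Set.Ioc a b).ncard :=
    (hX.measurable_ncard_flipTimes i hab le_rfl hb).mono (hX.pathHistory_le hb) le_rfl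
  have h2 : MeasurableSet {ω | a ∈ flipTimes X i ω} :=
    hX.pathHistory_le (hab.trans hb) _ (hX.measurableSet_mem_flipTimes i (hab.trans hb))
  exact (h1.add (Measurable.ite h2 measurable_const measurable_const))
    (measurableSet_singleton k)

lemma measurableSet_flipEvent (hX : IsSingleSiteChain μ P T X U) (i j : Fin n)
    (l : List (Fin n)) (ε t : ℝ≥0) (ht : t + l.length * ε ≤ T) :
    MeasurableSet (flipEvent X i j l ε t) := by
  unfold flipEvent
  simp only [Set.ofPred_forall, Set.ofPred_and]
  refine MeasurableSet.iInter fun k => ?_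
  have h1 : t + (k : ℕ) * ε ≤ t + ((k : ℕ) + 1) * ε := by
    gcongr
    exact le_self_add
  have h2 : t + ((k : ℕ) + 1) * ε ≤ T := by
    refine le_trans ?_ ht
    gcongr
    exact_mod_cast k.2
  exact (hX.measurableSet_encard_flipTimes _ h1 h2 1).inter
    (hX.measurableSet_encard_flipTimes _ h1 h2 0)

end IsSingleSiteChain

/-! ### Locality of the kernels -/

/-- The neighbours of `i` in the dependence graph of `A`. -/
noncomputable def neighbors {n : ℕ} (A : Matrix (Fin n) (Fin n) ℝ) (i : Fin n) :
    Finset (Fin n) :=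
  {k : Fin n | k ≠ i ∧ A i k ≠ 0}.toFinite.toFinset

lemma mem_neighbors {n : ℕ} {A : Matrix (Fin n) (Fin n) ℝ} {i k : Fin n} :
    k ∈ neighbors A i ↔ k ≠ i ∧ A i k ≠ 0 := by
  simp [neighbors]

lemma card_neighbors_le {n d : ℕ} {A : Matrix (Fin n) (Fin n) ℝ} (hA : DegreeAtMost A d)
    (i : Fin n) : (neighbors A i).card ≤ d := by
  rw [neighbors, ← Set.ncard_eq_toFinset_card]
  exact hA i

lemma isingWeight_pos {n : ℕ} (A : Matrix (Fin n) (Fin n) ℝ) (h : Fin n → ℝ) (x : Config n) :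
    0 < isingWeight A h x :=
  Real.exp_pos _

lemma isingProb_pos {n : ℕ} (A : Matrix (Fin n) (Fin n) ℝ) (h : Fin n → ℝ) (x : Config n) :
    0 < isingProb A h x :=
  div_pos (isingWeight_pos A h x) (Finset.sum_pos (fun y _ => isingWeight_pos A h y)
    ⟨x, Finset.mem_univ x⟩)

namespace Config

variable {n : ℕ}

lemma flip_singleton_apply_self (x : Config n) (i : Fin n) : x.flip {i} i = -x i := by
  simp [flip]

lemma flip_singleton_apply_of_ne (x : Config n) {i k : Fin n} (h : k ≠ i) :
    x.flip {i} k = x k := by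
  simp [flip, h]

lemma flip_flip (x : Config n) (S S' : Multiset (Fin n)) : (x.flip S).flip S' = x.flip (S + S') := by
  funext i
  simp only [flip, Multiset.count_add, pow_add]
  rw [mul_assoc, mul_left_comm]

lemma flip_zero (x : Config n) : x.flip 0 = x := by
  funext i
  simp [flip]

lemma reset_eq_self {x : Config n} {i : Fin n} {a : ℤˣ} (h : x i = a) : x.reset i a = x := by
  rw [reset, ← h, Function.update_eq_self]

lemma flip_singleton_eq_reset {x : Config n} {i : Fin n} {a : ℤˣ} (h : x i = -a) :
    x.flip {i} = x.reset i a := by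
  funext k
  by_cases hk : k = i
  · subst hk
    simp [flip_singleton_apply_self, reset, h]
  · simp [flip_singleton_apply_of_ne x hk, reset, hk]

lemma toReal_reset_one (x : Config n) (i : Fin n) :
    (x.reset i 1).toReal = (x.reset i (-1)).toReal + Pi.single i 2 := by
  funext k
  by_cases hk : k = i
  · subst hk
    norm_num [toReal, reset]
  · simp [toReal, reset, hk]

end Config

/-- The normalisation cancels, and raising spin `i` adds `2` times a basis vector to the
configuration; expanding the quadratic form, with `A` symmetric, leaves the local field at `i`. -/
lemma isingProb_ratio {n : ℕ} {A : Matrix (Fin n) (Fin n) ℝ} (hA : A.IsSymm) (h : Fin n → ℝ)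
    (x : Config n) (i : Fin n) :
    isingProb A h (x.reset i 1) / isingProb A h (x.reset i (-1)) =
      Real.exp (2 * (A.mulVec (x.reset i (-1)).toReal) i + 2 * A i i + 2 * h i) := by
  have hZ : (∑ y : Config n, isingWeight A h y) ≠ 0 :=
    (Finset.sum_pos (fun y _ => isingWeight_pos A h y) ⟨x, Finset.mem_univ x⟩).ne'
  rw [isingProb, isingProb, div_div_div_cancel_right₀ hZ, isingWeight, isingWeight, ← Real.exp_sub,
    Config.toReal_reset_one]
  congr 1
  set v := (x.reset i (-1)).toReal
  have h1 : v ⬝ᵥ A.mulVec (Pi.single i 2) = 2 * (A.mulVec v) i := by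
    rw [Matrix.dotProduct_mulVec, ← Matrix.mulVec_transpose, hA.eq, dotProduct_single]
    ring
  have h2 : (Pi.single i (2 : ℝ)) ⬝ᵥ A.mulVec (Pi.single i 2) = 4 * A i i := by
    rw [single_dotProduct, Matrix.mulVec_single]
    simp
    ring
  rw [Matrix.mulVec_add, add_dotProduct, dotProduct_add, dotProduct_add, dotProduct_add, h1, h2,
    single_dotProduct, dotProduct_single]
  ring

/-- The probability of flipping site `i` depends only on the spins of `i` and its neighbours. -/
lemma kernel_flip_congr {n : ℕ} {A : Matrix (Fin n) (Fin n) ℝ} {h : Fin n → ℝ}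
    {P : Fin n → Config n → Config n → ℝ} (hA : A.IsSymm)
    (hrev : IsReversible (isingProb A h) P) (hcons : IsSiteConsistent (isingProb A h) P)
    {i : Fin n} {x y : Config n} (hi : x i = y i) (hxy : ∀ k ∈ neighbors A i, x k = y k) :
    P i x (x.flip {i}) = P i y (y.flip {i}) := by
  obtain ⟨f, -, -, hf⟩ := hcons i
  have hratio : isingProb A h (x.reset i 1) / isingProb A h (x.reset i (-1)) =
      isingProb A h (y.reset i 1) / isingProb A h (y.reset i (-1)) := by
    rw [isingProb_ratio hA, isingProb_ratio hA]
    suffices hs : A.mulVec (x.reset i (-1)).toReal i = A.mulVec (y.reset i (-1)).toReal i by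
      rw [hs]
    simp only [Matrix.mulVec, dotProduct]
    refine Finset.sum_congr rfl fun k _ => ?_
    by_cases hk : k = i
    · subst hk
      simp [Config.toReal, Config.reset]
    by_cases hAk : A i k = 0
    · simp [hAk]
    · simp [Config.toReal, Config.reset, hk, hxy k (mem_neighbors.2 ⟨hk, hAk⟩)]
  have hup : P i (x.reset i (-1)) (x.reset i 1) = P i (y.reset i (-1)) (y.reset i 1) := by
    rw [hf, hf, hratio]
  -- Site-consistency speaks only of moves from `-1` to `1`; detailed balance turns the reverse move
  -- into the upward one divided by the ratio.
  have hdown : ∀ z : Config n, z i = 1 → P i z (z.flip {i}) =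
      P i (z.reset i (-1)) (z.reset i 1) /
        (isingProb A h (z.reset i 1) / isingProb A h (z.reset i (-1))) := by
    intro z hz
    have h1 := hrev i z
    have h2 : z.flip {i} = z.reset i (-1) := Config.flip_singleton_eq_reset (by simpa using hz)
    have h3 := isingProb_pos A h z
    have h4 := isingProb_pos A h (z.reset i (-1))
    rw [h2] at h1 ⊢
    rw [Config.reset_eq_self hz]
    field_simp
    linarith
  rcases Int.units_eq_one_or (x i) with hx | hx
  · rw [hdown x hx, hdown y (hi ▸ hx), hup, hratio]
  · have hy : y i = -1 := hi ▸ hx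
    rw [Config.flip_singleton_eq_reset (a := 1) hx, Config.flip_singleton_eq_reset (a := 1) hy]
    rwa [Config.reset_eq_self hx, Config.reset_eq_self hy] at hup

lemma IsSiteKernel.le_one {n : ℕ} {P : Fin n → Config n → Config n → ℝ} (hP : IsSiteKernel P)
    (i : Fin n) (x y : Config n) : P i x y ≤ 1 :=
  hP.sum_eq_one i x ▸ Finset.single_le_sum (fun z _ => hP.nonneg i x z) (Finset.mem_univ y)

lemma transitionProd_nil {n : ℕ} (P : Fin n → Config n → Config n → ℝ) (x : Config n) :
    transitionProd P [] x = 1 := by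
  simp [transitionProd]

lemma transitionProd_cons {n : ℕ} (P : Fin n → Config n → Config n → ℝ) (a : Fin n)
    (l : List (Fin n)) (x : Config n) :
    transitionProd P (a :: l) x = P a x (x.flip {a}) * transitionProd P l (x.flip {a}) := by
  unfold transitionProd
  change ∏ k : Fin (l.length + 1), _ = _
  rw [Fin.prod_univ_succ]
  congr 1
  · simp [Config.flip_zero]
  · refine Finset.prod_congr rfl fun k _ => ?_
    simp [Config.flip_flip, ← Multiset.cons_coe, Multiset.singleton_add]

lemma transitionProd_nonneg {n : ℕ} {P : Fin n → Config n → Config n → ℝ} (hP : IsSiteKernel P)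
    (l : List (Fin n)) (x : Config n) : 0 ≤ transitionProd P l x :=
  Finset.prod_nonneg fun _ _ => hP.nonneg _ _ _

lemma transitionProd_le_one {n : ℕ} {P : Fin n → Config n → Config n → ℝ} (hP : IsSiteKernel P)
    (l : List (Fin n)) (x : Config n) : transitionProd P l x ≤ 1 :=
  Finset.prod_le_one (fun _ _ => hP.nonneg _ _ _) fun _ _ => hP.le_one _ _ _

/-- Peeling off the first window leaves the same event started at `t + ε`, the form needed for
induction on the list. -/
lemma flipEvent_cons {n : ℕ} {Ω : Type*} (X : ℝ≥0 → Ω → Config n) (i j a : Fin n)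
    (l : List (Fin n)) (ε t : ℝ≥0) :
    flipEvent X i j (a :: l) ε t =
      {ω | (flipTimes X a ω ∩ Set.Icc t (t + ε)).encard = 1 ∧
        (flipTimes X (if a = i then j else i) ω ∩ Set.Icc t (t + ε)).encard = 0} ∩
      flipEvent X i j l ε (t + ε) := by
  ext ω
  have e1 : ∀ k : ℕ, t + ((k + 1 : ℕ) : ℝ≥0) * ε = t + ε + k * ε := fun k => by push_cast; ring
  have e2 : ∀ k : ℕ, t + (((k + 1 : ℕ) : ℝ≥0) + 1) * ε = t + ε + (k + 1) * ε :=
    fun k => by push_cast; ring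
  change (∀ k : Fin (l.length + 1), _) ↔ _
  rw [Fin.forall_fin_succ]
  simp only [Fin.val_succ, e1, e2]
  simp [flipEvent]
  exact fun _ _ => Iff.rfl

/-! ### Update counts -/

/-- No site of `S` is updated in `(s, t]`. -/
def noUpdate {n : ℕ} {Ω : Type*} (U : Fin n → Ω → Set ℝ≥0) (S : Finset (Fin n)) (s t : ℝ≥0) :
    Set Ω :=
  {ω | ∀ q ∈ S, (U q ω ∩ Set.Ioc s t).ncard = 0}

/-- The only update of a site of `S` in `(s, t]` is one of site `a`. -/
def soleUpdate {n : ℕ} {Ω : Type*} (U : Fin n → Ω → Set ℝ≥0) (S : Finset (Fin n)) (a : Fin n)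
    (s t : ℝ≥0) : Set Ω :=
  {ω | (U a ω ∩ Set.Ioc s t).ncard = 1 ∧ ∀ q ∈ S, q ≠ a → (U q ω ∩ Set.Ioc s t).ncard = 0}

/-- Site `a` is updated in `(s, t]`. -/
def someUpdate {n : ℕ} {Ω : Type*} (U : Fin n → Ω → Set ℝ≥0) (a : Fin n) (s t : ℝ≥0) : Set Ω :=
  {ω | (U a ω ∩ Set.Ioc s t).ncard ≠ 0}

/-- The σ-algebra generated by the numbers of updates in `(s, t]`. -/
@[reducible] noncomputable def incrementHistory {n : ℕ} {Ω : Type*} (U : Fin n → Ω → Set ℝ≥0)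
    (s t : ℝ≥0) : MeasurableSpace Ω :=
  ⨆ i, MeasurableSpace.comap (fun ω => (U i ω ∩ Set.Ioc s t).ncard) ⊤

section

variable {n : ℕ} {Ω : Type*} {U : Fin n → Ω → Set ℝ≥0} {s t : ℝ≥0}

lemma measurable_incrementHistory (U : Fin n → Ω → Set ℝ≥0) (s t : ℝ≥0) (i : Fin n) :
    Measurable[incrementHistory U s t] fun ω => (U i ω ∩ Set.Ioc s t).ncard :=
  measurable_iff_comap_le.2 (le_iSup_of_le i le_rfl)

lemma measurableSet_noUpdate (S : Finset (Fin n)) :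
    MeasurableSet[incrementHistory U s t] (noUpdate U S s t) := by
  simp only [noUpdate, Set.ofPred_forall]
  exact MeasurableSet.iInter fun q => MeasurableSet.iInter fun _ =>
    measurable_incrementHistory U s t q (measurableSet_singleton 0)

lemma measurableSet_soleUpdate (S : Finset (Fin n)) (a : Fin n) :
    MeasurableSet[incrementHistory U s t] (soleUpdate U S a s t) := by
  simp only [soleUpdate, Set.ofPred_and, Set.ofPred_forall]
  exact (measurable_incrementHistory U s t a (measurableSet_singleton 1)).inter
    (MeasurableSet.iInter fun q => MeasurableSet.iInter fun _ => MeasurableSet.iInter fun _ =>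
      measurable_incrementHistory U s t q (measurableSet_singleton 0))

lemma measurableSet_someUpdate (a : Fin n) :
    MeasurableSet[incrementHistory U s t] (someUpdate U a s t) :=
  (measurable_incrementHistory U s t a (measurableSet_singleton 0)).compl

lemma soleUpdate_subset_someUpdate (S : Finset (Fin n)) (a : Fin n) :
    soleUpdate U S a s t ⊆ someUpdate U a s t := fun ω hω => by
  simp [someUpdate, hω.1]

end

/-- Integrate the conditional probability over `F`, where it is constant. -/
lemma measureReal_inter_eq_of_condExp {Ω : Type*} {m mΩ : MeasurableSpace Ω} {μ : Measure Ω}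
    [IsFiniteMeasure μ] (hm : m ≤ mΩ) {F A : Set Ω} (hF : MeasurableSet[m] F)
    (hA : MeasurableSet[mΩ] A) {p : ℝ} (h : ∀ᵐ ω ∂μ, ω ∈ F → (μ⟦A | m⟧) ω = p) :
    μ.real (F ∩ A) = p * μ.real F := by
  have h1 : μ.real (F ∩ A) = ∫ ω in F, (μ⟦A | m⟧) ω ∂μ := by
    rw [setIntegral_condExp hm ((integrable_const (1 : ℝ)).indicator hA) hF,
      integral_indicator_const _ hA, smul_eq_mul, mul_one, measureReal_restrict_apply hA,
      Set.inter_comm]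
  rw [h1, setIntegral_congr_ae (hm _ hF) h, setIntegral_const, smul_eq_mul, mul_comm]

namespace IsSingleSiteChain

variable {n : ℕ} {Ω : Type*} [mΩ : MeasurableSpace Ω] {μ : Measure Ω}
  {P : Fin n → Config n → Config n → ℝ} {T : ℝ≥0}
  {X : ℝ≥0 → Ω → Config n} {U : Fin n → Ω → Set ℝ≥0}

lemma incrementHistory_le_pointHistory (hX : IsSingleSiteChain μ P T X U) {s t : ℝ≥0}
    (hst : s ≤ t) (htT : t ≤ T) : incrementHistory U s t ≤ pointHistory U t :=
  iSup_le fun i => measurable_iff_comap_le.1 (hX.measurable_updates i hst le_rfl htT)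

lemma incrementHistory_le (hX : IsSingleSiteChain μ P T X U) {s t : ℝ≥0}
    (hst : s ≤ t) (htT : t ≤ T) : incrementHistory U s t ≤ mΩ :=
  (hX.incrementHistory_le_pointHistory hst htT).trans (hX.pointHistory_le htT)

lemma measureReal_inter (hX : IsSingleSiteChain μ P T X U) {s t : ℝ≥0}
    (hst : s ≤ t) (htT : t ≤ T) {B E : Set Ω} (hB : MeasurableSet[fullHistory X U s] B)
    (hE : MeasurableSet[incrementHistory U s t] E) :
    μ.real (B ∩ E) = μ.real B * μ.real E := by
  rw [Set.inter_comm, measureReal_def, (Indep_iff _ _ μ).1 (hX.indep_past s t hst htT) E B hE hB,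
    ENNReal.toReal_mul, mul_comm]
  rfl

lemma measureReal_count (hX : IsSingleSiteChain μ P T X U) {s t : ℝ≥0}
    (hst : s ≤ t) (htT : t ≤ T) (i : Fin n) (k : ℕ) :
    μ.real {ω | (U i ω ∩ Set.Ioc s t).ncard = k} =
      Real.exp (-(t - s : ℝ≥0)) * (t - s : ℝ≥0) ^ k / (k.factorial : ℝ) := by
  rw [← poissonMeasure_real_singleton, ← hX.law_count i s t hst htT, map_measureReal_apply]
  · rfl
  · exact ((hX.measurable_updates i hst le_rfl htT).mono (hX.pointHistory_le htT) le_rfl)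
  · exact measurableSet_singleton k

lemma measureReal_someUpdate [IsProbabilityMeasure μ] (hX : IsSingleSiteChain μ P T X U)
    {s t : ℝ≥0} (hst : s ≤ t) (htT : t ≤ T) (a : Fin n) :
    μ.real (someUpdate U a s t) = 1 - Real.exp (-(t - s : ℝ≥0)) := by
  have h : someUpdate U a s t = {ω | (U a ω ∩ Set.Ioc s t).ncard = 0}ᶜ := rfl
  rw [h, probReal_compl_eq_one_sub, hX.measureReal_count hst htT]
  · simp
  · exact hX.incrementHistory_le hst htT _
      (measurable_incrementHistory U s t a (measurableSet_singleton 0))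

lemma measureReal_someUpdate_le [IsProbabilityMeasure μ] (hX : IsSingleSiteChain μ P T X U)
    {s t : ℝ≥0} (hst : s ≤ t) (htT : t ≤ T) (a : Fin n) :
    μ.real (someUpdate U a s t) ≤ (t - s : ℝ≥0) := by
  rw [hX.measureReal_someUpdate hst htT]
  linarith [Real.one_sub_le_exp_neg ((t - s : ℝ≥0) : ℝ)]

lemma measureReal_someUpdate_inter_le [IsProbabilityMeasure μ] (hX : IsSingleSiteChain μ P T X U)
    {s t : ℝ≥0} (hst : s ≤ t) (htT : t ≤ T) {a b : Fin n} (hab : a ≠ b) :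
    μ.real (someUpdate U a s t ∩ someUpdate U b s t) ≤ ((t - s : ℝ≥0) : ℝ) ^ 2 := by
  have h := ((hX.indep_sites s t hst htT).indepFun hab).measure_inter_preimage_eq_mul {0}ᶜ {0}ᶜ
    (measurableSet_singleton 0).compl (measurableSet_singleton 0).compl
  have h' : μ.real (someUpdate U a s t ∩ someUpdate U b s t) =
      μ.real (someUpdate U a s t) * μ.real (someUpdate U b s t) := by
    rw [measureReal_def, measureReal_def, measureReal_def, ← ENNReal.toReal_mul]
    exact congrArg _ h
  rw [h', sq]
  exact mul_le_mul (hX.measureReal_someUpdate_le hst htT a)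
    (hX.measureReal_someUpdate_le hst htT b) measureReal_nonneg (NNReal.coe_nonneg _)

/-- By independence of sites, each of the `S.card` sites contributes a factor `exp (-(t - s))`, and
`a` an extra factor `t - s` for its single point. -/
lemma measureReal_soleUpdate (hX : IsSingleSiteChain μ P T X U)
    {s t : ℝ≥0} (hst : s ≤ t) (htT : t ≤ T) {S : Finset (Fin n)} {a : Fin n} (ha : a ∈ S) :
    μ.real (soleUpdate U S a s t) =
      (t - s : ℝ≥0) * Real.exp (-(S.card * (t - s : ℝ≥0))) := by
  have h := (hX.indep_sites s t hst htT).measure_inter_preimage_eq_mul S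
    (sets := fun q => {if q = a then 1 else 0}) fun _ _ => measurableSet_singleton _
  have hset : soleUpdate U S a s t = ⋂ q ∈ S, (fun ω => (U q ω ∩ Set.Ioc s t).ncard) ⁻¹'
      {if q = a then 1 else 0} := by
    ext ω
    simp only [soleUpdate, Set.mem_ofPred_eq, Set.mem_iInter, Set.mem_preimage,
      Set.mem_singleton_iff]
    refine ⟨fun hω q hq => ?_, fun hω => ⟨by simpa using hω a ha, fun q hq hqa => ?_⟩⟩
    · split_ifs with hqa
      · rw [hqa, hω.1]
      · exact hω.2 q hq hqa
    · simpa [hqa] using hω q hq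
  have hq : ∀ q, (μ ((fun ω => (U q ω ∩ Set.Ioc s t).ncard) ⁻¹' {if q = a then 1 else 0})).toReal =
      Real.exp (-(t - s : ℝ≥0)) * if q = a then ((t - s : ℝ≥0) : ℝ) else 1 := by
    intro q
    have := hX.measureReal_count hst htT q (if q = a then 1 else 0)
    refine this.trans ?_
    split_ifs <;> simp
  rw [hset, measureReal_def, h, ENNReal.toReal_prod, Finset.prod_congr rfl fun q _ => hq q,
    Finset.prod_mul_distrib, Finset.prod_const, Finset.prod_ite_eq' S a, if_pos ha, mul_comm,
    ← Real.exp_nat_mul, mul_neg]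

/-- An update at `s` is an update in `(r, s]` for every `r < s`, which has probability at most `s -
r`. -/
lemma ae_notMem_update [IsProbabilityMeasure μ] (hX : IsSingleSiteChain μ P T X U) {s : ℝ≥0}
    (hs : s ≤ T) (a : Fin n) : ∀ᵐ ω ∂μ, s ∉ U a ω := by
  rcases eq_zero_or_pos s with rfl | hs0
  · exact Eventually.of_forall fun ω => hX.zero_notMem a ω
  have hle : ∀ r < s, μ.real {ω | s ∈ U a ω} ≤ (s : ℝ) - r := by
    intro r hr
    have hsub : {ω | s ∈ U a ω} ⊆ someUpdate U a r s := fun ω hω =>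
      ((Set.ncard_pos (hX.finite_Ioc a ω r hs)).2 ⟨s, hω, hr, le_rfl⟩).ne'
    refine (measureReal_mono hsub).trans ((hX.measureReal_someUpdate_le hr.le hs a).trans ?_)
    rw [NNReal.coe_sub hr.le]
  have h0 : μ.real {ω | s ∈ U a ω} ≤ 0 := by
    refine le_of_forall_pos_le_add fun δ hδ => ?_
    have hlt : s - δ.toNNReal < s := tsub_lt_self hs0 (Real.toNNReal_pos.2 hδ)
    refine (hle _ hlt).trans ?_
    have : (s : ℝ) ≤ ((s - δ.toNNReal : ℝ≥0) : ℝ) + δ := by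
      nth_rewrite 2 [← Real.coe_toNNReal δ hδ.le]
      exact_mod_cast le_tsub_add
    linarith
  rw [ae_iff]
  simpa [measureReal_eq_zero_iff] using h0.antisymm measureReal_nonneg

/-! ### The law of a sole update -/

/-- If the sites of `S` are not updated in `(s, u]` and the only update in `(u, v]` is one of
site `a`, then site `a` flips with the probability given by the kernel. -/
lemma measureReal_flip_of_soleUpdate_univ [IsProbabilityMeasure μ]
    (hX : IsSingleSiteChain μ P T X U) {S : Finset (Fin n)} {a : Fin n} {x : Config n} {p : ℝ}
    (hp : ∀ z : Config n, (∀ q ∈ S, z q = x q) → P a z (z.flip {a}) = p)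
    {s u v : ℝ≥0} (hsu : s ≤ u) (huv : u ≤ v) (hvT : v ≤ T) {B : Set Ω}
    (hB : MeasurableSet[fullHistory X U s] B) (hBx : ∀ ω ∈ B, ∀ q ∈ S, X s ω q = x q) :
    μ.real (B ∩ noUpdate U S s u ∩ soleUpdate U Finset.univ a u v ∩ {ω | X v ω a ≠ X u ω a}) =
      p * μ.real (B ∩ noUpdate U S s u ∩ soleUpdate U Finset.univ a u v) := by
  set E := B ∩ noUpdate U S s u ∩ soleUpdate U Finset.univ a u v with hE
  have hm : pathHistory X u ⊔ pointHistory U v ≤ mΩ := sup_le (hX.pathHistory_le (huv.trans hvT)) (hX.pointHistory_le hvT)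
  -- This is the σ-algebra of the `update` axiom: `E` involves spins only up to `s` and update times
  -- up to `v`.
  have hEm : MeasurableSet[pathHistory X u ⊔ pointHistory U v] E := by
    refine (MeasurableSet.inter ?_ ?_).inter ?_
    · refine (?_ : fullHistory X U s ≤ pathHistory X u ⊔ pointHistory U v) _ hB
      exact sup_le_sup (pathHistory_mono X hsu) (pointHistory_mono U (hsu.trans huv))
    · refine (?_ : incrementHistory U s u ≤ pathHistory X u ⊔ pointHistory U v) _ (measurableSet_noUpdate S)
      exact (hX.incrementHistory_le_pointHistory hsu (huv.trans hvT)).trans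
        ((pointHistory_mono U huv).trans le_sup_right)
    · refine (?_ : incrementHistory U u v ≤ pathHistory X u ⊔ pointHistory U v) _ (measurableSet_soleUpdate Finset.univ a)
      exact (hX.incrementHistory_le_pointHistory huv hvT).trans le_sup_right
  have hzm : ∀ z, MeasurableSet[pathHistory X u ⊔ pointHistory U v] (E ∩ X u ⁻¹' {z}) := fun z =>
    hEm.inter ((le_sup_left : pathHistory X u ≤ pathHistory X u ⊔ pointHistory U v) _ (measurableSet_spin X le_rfl (· = z)))
  have hsplit : ∀ F : Set Ω, MeasurableSet F →
      μ.real F = ∑ z : Config n, μ.real (F ∩ X u ⁻¹' {z}) := by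
    intro F hF
    rw [← measureReal_iUnion_fintype]
    · congr 1
      ext ω
      simp
    · intro z z' hzz'
      refine Set.disjoint_left.2 fun ω h1 h2 => hzz' ?_
      exact h1.2.symm.trans h2.2
    · exact fun z => hF.inter (hX.measurable_path u (huv.trans hvT) z)
  -- Since no other site is updated in `(u, v]`, a change at `a` determines the whole configuration
  -- at `v`; the decomposition over `X u` makes the target configuration deterministic.
  have hflip : ∀ z, E ∩ {ω | X v ω a ≠ X u ω a} ∩ X u ⁻¹' {z} =
      E ∩ X u ⁻¹' {z} ∩ X v ⁻¹' {z.flip {a}} := by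
    intro z
    ext ω
    constructor
    · rintro ⟨⟨hωE, hne⟩, rfl⟩
      refine ⟨⟨hωE, rfl⟩, ?_⟩
      funext k
      by_cases hk : k = a
      · subst hk
        rw [Config.flip_singleton_apply_self]
        exact Int.units_ne_iff_eq_neg.1 hne
      · rw [Config.flip_singleton_apply_of_ne _ hk]
        exact hX.eq_of_no_update ω k u v huv hvT
          ((Set.ncard_eq_zero (hX.finite_Ioc k ω u hvT)).1 (hωE.2.2 k (Finset.mem_univ k) hk))
    · rintro ⟨⟨hωE, rfl⟩, hv⟩
      refine ⟨⟨hωE, ?_⟩, rfl⟩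
      have hv' : X v ω = (X u ω).flip {a} := hv
      rw [Set.mem_ofPred_eq, hv', Config.flip_singleton_apply_self]
      exact Int.units_ne_iff_eq_neg.2 rfl
  have hz : ∀ z, μ.real (E ∩ X u ⁻¹' {z} ∩ X v ⁻¹' {z.flip {a}}) =
      p * μ.real (E ∩ X u ⁻¹' {z}) := by
    intro z
    have hvmeas := hX.measurable_path v hvT (z.flip {a})
    refine measureReal_inter_eq_of_condExp hm (hzm z) hvmeas ?_
    filter_upwards [hX.update a u v huv hvT (z.flip {a})] with ω hω hωE
    rw [hω hωE.1.2.1 fun k hk => (Set.ncard_eq_zero (hX.finite_Ioc k ω u hvT)).1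
      (hωE.1.2.2 k (Finset.mem_univ k) hk)]
    have hz' : X u ω = z := hωE.2
    rw [hz']
    refine hp z fun q hq => ?_
    rw [← hz', ← hBx ω hωE.1.1.1 q hq]
    exact hX.eq_of_no_update ω q s u hsu (huv.trans hvT)
      ((Set.ncard_eq_zero (hX.finite_Ioc q ω s (huv.trans hvT))).1 (hωE.1.1.2 q hq))
  have hne : MeasurableSet {ω | X v ω a ≠ X u ω a} :=
    (hX.pathHistory_le hvT _ (measurableSet_spin_eq X le_rfl huv a)).compl
  rw [hsplit _ ((hm _ hEm).inter hne), hsplit E (hm _ hEm), Finset.mul_sum]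
  exact Finset.sum_congr rfl fun z _ => by rw [hflip, hz]
end IsSingleSiteChain

/-! ### Flip probability when the other updates are excluded only within `S`. -/

lemma measurableSet_spin_ne {n : ℕ} {Ω : Type*} (X : ℝ≥0 → Ω → Config n)
    (U : Fin n → Ω → Set ℝ≥0) {u v : ℝ≥0} (huv : u ≤ v) (a : Fin n) :
    MeasurableSet[fullHistory X U v] {ω | X v ω a ≠ X u ω a} :=
  ((le_sup_left : pathHistory X v ≤ fullHistory X U v) _
    (measurableSet_spin_eq X le_rfl huv a)).compl

/-- The part of the event that the sole update of `S` in `(s, t]` is one of site `a` on which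
that update happens in `(u, v]` and no other site is updated in `(u, v]`. -/
def isolatedUpdate {n : ℕ} {Ω : Type*} (U : Fin n → Ω → Set ℝ≥0) (S : Finset (Fin n)) (a : Fin n)
    (s u v t : ℝ≥0) : Set Ω :=
  noUpdate U S s u ∩ soleUpdate U Finset.univ a u v ∩ noUpdate U S v t

namespace IsSingleSiteChain

variable {n : ℕ} {Ω : Type*} [mΩ : MeasurableSpace Ω] {μ : Measure Ω}
  {P : Fin n → Config n → Config n → ℝ} {T : ℝ≥0}
  {X : ℝ≥0 → Ω → Config n} {U : Fin n → Ω → Set ℝ≥0}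

lemma incrementHistory_le_fullHistory (hX : IsSingleSiteChain μ P T X U) {s t : ℝ≥0}
    (hst : s ≤ t) (htT : t ≤ T) : incrementHistory U s t ≤ fullHistory X U t :=
  (hX.incrementHistory_le_pointHistory hst htT).trans le_sup_right

lemma spin_eq_of_ncard (hX : IsSingleSiteChain μ P T X U) {i : Fin n} {ω : Ω} {s t : ℝ≥0}
    (hst : s ≤ t) (htT : t ≤ T) (h : (U i ω ∩ Set.Ioc s t).ncard = 0) : X t ω i = X s ω i :=
  hX.eq_of_no_update ω i s t hst htT ((Set.ncard_eq_zero (hX.finite_Ioc i ω s htT)).1 h)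

lemma measurableSet_isolatedUpdate (hX : IsSingleSiteChain μ P T X U) (S : Finset (Fin n))
    (a : Fin n) {s u v t : ℝ≥0} (hsu : s ≤ u) (huv : u ≤ v) (hvt : v ≤ t) (htT : t ≤ T) :
    MeasurableSet (isolatedUpdate U S a s u v t) :=
  ((hX.incrementHistory_le hsu (huv.trans (hvt.trans htT)) _ (measurableSet_noUpdate S)).inter
    (hX.incrementHistory_le huv (hvt.trans htT) _ (measurableSet_soleUpdate Finset.univ a))).inter
      (hX.incrementHistory_le hvt htT _ (measurableSet_noUpdate S))

/-- Absence of updates of `S` after `v` is independent of the past and contributes the same factor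
to both sides. As `a` is not updated in `(s, u]` or `(v, t]`, its spin changes over `(s, t]` exactly
when it does over `(u, v]`. -/
lemma measureReal_flip_of_isolatedUpdate [IsProbabilityMeasure μ]
    (hX : IsSingleSiteChain μ P T X U) {S : Finset (Fin n)} {a : Fin n} (ha : a ∈ S)
    {x : Config n} {p : ℝ}
    (hp : ∀ z : Config n, (∀ q ∈ S, z q = x q) → P a z (z.flip {a}) = p)
    {s u v t : ℝ≥0} (hsu : s ≤ u) (huv : u ≤ v) (hvt : v ≤ t) (htT : t ≤ T) {B : Set Ω}
    (hB : MeasurableSet[fullHistory X U s] B) (hBx : ∀ ω ∈ B, ∀ q ∈ S, X s ω q = x q) :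
    μ.real (B ∩ isolatedUpdate U S a s u v t ∩ {ω | X t ω a ≠ X s ω a}) =
      p * μ.real (B ∩ isolatedUpdate U S a s u v t) := by
  have hvT := hvt.trans htT
  have huT := huv.trans hvT
  set C := B ∩ noUpdate U S s u ∩ soleUpdate U Finset.univ a u v with hC
  have h1 : B ∩ isolatedUpdate U S a s u v t = C ∩ noUpdate U S v t := by
    rw [isolatedUpdate, hC, Set.inter_assoc B, ← Set.inter_assoc]
  have h2 : B ∩ isolatedUpdate U S a s u v t ∩ {ω | X t ω a ≠ X s ω a} =
      C ∩ {ω | X v ω a ≠ X u ω a} ∩ noUpdate U S v t := by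
    rw [h1, Set.inter_right_comm]
    ext ω
    refine and_congr_left fun hpost => and_congr_right fun hω => ?_
    rw [Set.mem_ofPred_eq, Set.mem_ofPred_eq, hX.spin_eq_of_ncard hvt htT (hpost a ha),
      hX.spin_eq_of_ncard hsu huT (hω.1.2 a ha)]
  have hCm : MeasurableSet[fullHistory X U v] C := by
    refine ((fullHistory_mono X U (hsu.trans huv) _ hB).inter ?_).inter ?_
    · exact fullHistory_mono X U huv _
        (hX.incrementHistory_le_fullHistory hsu huT _ (measurableSet_noUpdate S))
    · exact hX.incrementHistory_le_fullHistory huv hvT _ (measurableSet_soleUpdate Finset.univ a)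
  rw [h2, h1, hX.measureReal_inter hvt htT hCm (measurableSet_noUpdate S),
    hX.measureReal_inter hvt htT (hCm.inter (measurableSet_spin_ne X U huv a))
      (measurableSet_noUpdate S),
    hX.measureReal_flip_of_soleUpdate_univ hp hsu huv hvT hB hBx, mul_assoc]

lemma ncard_updates_eq_add (hX : IsSingleSiteChain μ P T X U) (q : Fin n) (ω : Ω)
    {s u v t : ℝ≥0} (hsu : s ≤ u) (huv : u ≤ v) (hvt : v ≤ t) (htT : t ≤ T) :
    (U q ω ∩ Set.Ioc s t).ncard = (U q ω ∩ Set.Ioc s u).ncard +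
      (U q ω ∩ Set.Ioc u v).ncard + (U q ω ∩ Set.Ioc v t).ncard := by
  rw [ncard_inter_Ioc_add (hX.finite_Ioc q ω s htT) (hsu.trans huv) hvt,
    ncard_inter_Ioc_add (hX.finite_Ioc q ω s (hvt.trans htT)) hsu huv]

lemma isolatedUpdate_subset_soleUpdate (hX : IsSingleSiteChain μ P T X U) {S : Finset (Fin n)}
    {a : Fin n} (ha : a ∈ S) {s u v t : ℝ≥0} (hsu : s ≤ u) (huv : u ≤ v) (hvt : v ≤ t)
    (htT : t ≤ T) : isolatedUpdate U S a s u v t ⊆ soleUpdate U S a s t := by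
  have hadd := fun q ω => hX.ncard_updates_eq_add q ω hsu huv hvt htT
  rintro ω ⟨⟨h1, h2⟩, h3⟩
  refine ⟨?_, fun q hq hqa => ?_⟩
  · rw [hadd, h1 a ha, h2.1, h3 a ha]
  · rw [hadd, h1 q hq, h2.2 q (Finset.mem_univ q) hqa, h3 q hq]

lemma mem_isolatedUpdate (hX : IsSingleSiteChain μ P T X U) {S : Finset (Fin n)}
    {a : Fin n} {s u v t : ℝ≥0} (hsu : s ≤ u) (huv : u ≤ v) (hvt : v ≤ t) (htT : t ≤ T) {ω : Ω}
    (hω : ω ∈ soleUpdate U S a s t) (ha : ω ∈ someUpdate U a u v)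
    (hother : ∀ q, q ≠ a → (U q ω ∩ Set.Ioc u v).ncard = 0) :
    ω ∈ isolatedUpdate U S a s u v t := by
  have hsum_a := hX.ncard_updates_eq_add a ω hsu huv hvt htT
  have ha' : (U a ω ∩ Set.Ioc u v).ncard ≠ 0 := ha
  rw [hω.1] at hsum_a
  refine ⟨⟨fun q hq => ?_, ⟨by omega, fun q _ => hother q⟩⟩, fun q hq => ?_⟩ <;>
  · rcases eq_or_ne q a with rfl | hqa
    · omega
    · have hsum_q := hX.ncard_updates_eq_add q ω hsu huv hvt htT
      rw [hω.2 q hq hqa] at hsum_q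
      omega

/-- The update of `a` lies in some piece. Either it is alone there, or another site, necessarily
outside `S`, is updated in the same short piece, which is a second-order event. -/
lemma soleUpdate_subset_partition (hX : IsSingleSiteChain μ P T X U) {S : Finset (Fin n)}
    {a : Fin n} {s t : ℝ≥0} (hst : s ≤ t) (htT : t ≤ T) (M : ℕ) :
    soleUpdate U S a s t ⊆
      (⋃ r ∈ Finset.range (M + 1), isolatedUpdate U S a s (partitionPoint s t M r)
        (partitionPoint s t M (r + 1)) t) ∪
      ⋃ r ∈ Finset.range (M + 1), ⋃ q ∈ Finset.univ.erase a,
        someUpdate U a (partitionPoint s t M r) (partitionPoint s t M (r + 1)) ∩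
        someUpdate U q (partitionPoint s t M r) (partitionPoint s t M (r + 1)) := by
  intro ω hω
  have hsum := ncard_inter_Ioc_eq_sum hst (hX.finite_Ioc a ω s htT) M
  rw [hω.1] at hsum
  obtain ⟨r, hr, hr0⟩ : ∃ r ∈ Finset.range (M + 1), (U a ω ∩ Set.Ioc (partitionPoint s t M r)
      (partitionPoint s t M (r + 1))).ncard ≠ 0 := by
    by_contra! hcon
    rw [Finset.sum_eq_zero hcon] at hsum
    exact one_ne_zero hsum
  by_cases hother : ∀ q, q ≠ a → (U q ω ∩ Set.Ioc (partitionPoint s t M r)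
      (partitionPoint s t M (r + 1))).ncard = 0
  · exact Or.inl (Set.mem_biUnion hr (hX.mem_isolatedUpdate (le_partitionPoint s t M r)
      (partitionPoint_mono s t M (Nat.le_succ r)) (partitionPoint_le hst (Finset.mem_range.1 hr))
      htT hω hr0 hother))
  · push Not at hother
    obtain ⟨q, hqa, hq⟩ := hother
    refine Or.inr (Set.mem_biUnion hr (Set.mem_biUnion (x := q) ?_ ⟨hr0, hq⟩))
    simpa using hqa

/-- The first event puts an update of `a` in piece `r`, which precedes piece `r'`, whereas the
second forbids updates of `a` before piece `r'`. -/
lemma disjoint_isolatedUpdate (hX : IsSingleSiteChain μ P T X U) {S : Finset (Fin n)}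
    {a : Fin n} (ha : a ∈ S) {s t : ℝ≥0} (hst : s ≤ t) (htT : t ≤ T) (M : ℕ) {r r' : ℕ}
    (hrr' : r < r') (hr' : r' ≤ M + 1) :
    Disjoint
      (isolatedUpdate U S a s (partitionPoint s t M r) (partitionPoint s t M (r + 1)) t)
      (isolatedUpdate U S a s (partitionPoint s t M r') (partitionPoint s t M (r' + 1)) t) := by
  refine Set.disjoint_left.2 fun ω h1 h2 => ?_
  have h3 := h2.1.1 a ha
  have h4 := h1.1.2.1
  have hsub : U a ω ∩ Set.Ioc (partitionPoint s t M r) (partitionPoint s t M (r + 1)) ⊆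
      U a ω ∩ Set.Ioc s (partitionPoint s t M r') := by
    gcongr
    · exact le_partitionPoint _ _ _ _
    · exact partitionPoint_mono _ _ _ hrr'
  have := Set.ncard_le_ncard hsub
    (hX.finite_Ioc a ω s ((partitionPoint_le hst hr').trans htT))
  omega

/-- If `X^s` agrees with `x` on `S` and the only update of `S` in `(s, t]` is one of site `a`,
then site `a` flips with probability `p`, the common value of the flip probabilities of all
configurations that agree with `x` on `S`; the other sites may be updated at will. -/
lemma measureReal_flip_of_soleUpdate [IsProbabilityMeasure μ]
    (hX : IsSingleSiteChain μ P T X U) {S : Finset (Fin n)} {a : Fin n} (ha : a ∈ S)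
    {x : Config n} {p : ℝ} (hp0 : 0 ≤ p) (hp1 : p ≤ 1)
    (hp : ∀ z : Config n, (∀ q ∈ S, z q = x q) → P a z (z.flip {a}) = p)
    {s t : ℝ≥0} (hst : s ≤ t) (htT : t ≤ T) {B : Set Ω}
    (hB : MeasurableSet[fullHistory X U s] B) (hBx : ∀ ω ∈ B, ∀ q ∈ S, X s ω q = x q) :
    μ.real (B ∩ soleUpdate U S a s t ∩ {ω | X t ω a ≠ X s ω a}) =
      p * μ.real (B ∩ soleUpdate U S a s t) := by
  set W := B ∩ soleUpdate U S a s t with hW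
  set F := {ω | X t ω a ≠ X s ω a}
  have hF : MeasurableSet F := hX.fullHistory_le htT _ (measurableSet_spin_ne X U hst a)
  have hB' : MeasurableSet B := hX.fullHistory_le (hst.trans htT) _ hB
  -- The identity is exact on `D`, the union of the isolated events; the remainder costs at most `M
  -- + 1` pieces times `n` sites times the square of the mesh.
  have key : ∀ M : ℕ, |μ.real (W ∩ F) - p * μ.real W| ≤
      (n * ((t - s : ℝ≥0) : ℝ) ^ 2) / ((M : ℝ) + 1) := by
    intro M
    set J : ℕ → Set Ω := fun r => isolatedUpdate U S a s (partitionPoint s t M r)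
      (partitionPoint s t M (r + 1)) t
    set D := ⋃ r ∈ Finset.range (M + 1), B ∩ J r with hD
    have hJm : ∀ r ∈ Finset.range (M + 1), MeasurableSet (B ∩ J r) := fun r hr =>
      hB'.inter (hX.measurableSet_isolatedUpdate S a (le_partitionPoint _ _ _ _)
        (partitionPoint_mono _ _ _ (Nat.le_succ r))
        (partitionPoint_le hst (Finset.mem_range.1 hr)) htT)
    have hdisj : Set.PairwiseDisjoint (Finset.range (M + 1) : Set ℕ) fun r => B ∩ J r := by
      intro r hr r' hr' hne
      have h1 := (Finset.mem_range.1 hr).le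
      have h2 := (Finset.mem_range.1 hr').le
      refine Disjoint.mono Set.inter_subset_right Set.inter_subset_right ?_
      rcases hne.lt_or_gt with hlt | hlt
      · exact hX.disjoint_isolatedUpdate ha hst htT M hlt h2
      · exact (hX.disjoint_isolatedUpdate ha hst htT M hlt h1).symm
    have hDm : MeasurableSet D := Finset.measurableSet_biUnion _ hJm
    have hDF : μ.real (D ∩ F) = p * μ.real D := by
      rw [hD, Set.iUnion₂_inter, measureReal_biUnion_finset _ fun r hr => (hJm r hr).inter hF,
        measureReal_biUnion_finset hdisj hJm, Finset.mul_sum]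
      · refine Finset.sum_congr rfl fun r hr => ?_
        exact hX.measureReal_flip_of_isolatedUpdate ha hp (le_partitionPoint _ _ _ _)
          (partitionPoint_mono _ _ _ (Nat.le_succ r))
          (partitionPoint_le hst (Finset.mem_range.1 hr)) htT hB hBx
      · exact hdisj.mono_on fun r _ => Set.inter_subset_left
    have hDW : D ⊆ W := by
      refine Set.iUnion₂_subset fun r hr => Set.inter_subset_inter_right _ ?_
      exact hX.isolatedUpdate_subset_soleUpdate ha (le_partitionPoint _ _ _ _)
          (partitionPoint_mono _ _ _ (Nat.le_succ r))
          (partitionPoint_le hst (Finset.mem_range.1 hr)) htT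
    have hrest : μ.real (W \ D) ≤ (n * ((t - s : ℝ≥0) : ℝ) ^ 2) / ((M : ℝ) + 1) := by
      have hsub : W \ D ⊆ ⋃ r ∈ Finset.range (M + 1), ⋃ q ∈ Finset.univ.erase a,
          someUpdate U a (partitionPoint s t M r) (partitionPoint s t M (r + 1)) ∩
          someUpdate U q (partitionPoint s t M r) (partitionPoint s t M (r + 1)) := by
        rintro ω ⟨hωW, hωD⟩
        refine (hX.soleUpdate_subset_partition hst htT M hωW.2).resolve_left fun hω => hωD ?_
        obtain ⟨r, hr, hωr⟩ := Set.mem_iUnion₂.1 hω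
        exact Set.mem_biUnion hr ⟨hωW.1, hωr⟩
      have hpiece : ∀ r ∈ Finset.range (M + 1), μ.real (⋃ q ∈ Finset.univ.erase a,
          someUpdate U a (partitionPoint s t M r) (partitionPoint s t M (r + 1)) ∩
          someUpdate U q (partitionPoint s t M r) (partitionPoint s t M (r + 1))) ≤
          n * (((t - s : ℝ≥0) : ℝ) / (M + 1)) ^ 2 := by
        intro r hr
        refine (measureReal_biUnion_finset_le _ _).trans ?_
        refine (Finset.sum_le_card_nsmul _ _ ((((t - s : ℝ≥0) : ℝ) / (M + 1)) ^ 2)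
          fun q hq => ?_).trans ?_
        · refine (hX.measureReal_someUpdate_inter_le (partitionPoint_mono _ _ _ (Nat.le_succ r))
            ((partitionPoint_le hst (Finset.mem_range.1 hr)).trans htT)
            (Finset.ne_of_mem_erase hq).symm).trans_eq ?_
          rw [partitionPoint_succ, add_tsub_cancel_left]
          push_cast
          rfl
        · rw [nsmul_eq_mul]
          gcongr
          exact (Finset.card_erase_le).trans_eq (Finset.card_fin n)
      refine (measureReal_mono hsub (measure_ne_top _ _)).trans ((measureReal_biUnion_finset_le _ _).trans
        ((Finset.sum_le_card_nsmul _ _ _ hpiece).trans_eq ?_))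
      have : ((M : ℝ) + 1) ≠ 0 := by positivity
      rw [nsmul_eq_mul, Finset.card_range]
      push_cast
      field_simp
    have hsplit1 : μ.real W = μ.real D + μ.real (W \ D) := by
      rw [← measureReal_inter_add_sdiff (μ := μ) (s := W) hDm,
        Set.inter_eq_self_of_subset_right hDW]
    have hsplit2 : μ.real (W ∩ F) = μ.real (D ∩ F) + μ.real ((W \ D) ∩ F) := by
      rw [← measureReal_inter_add_sdiff (μ := μ) (s := W ∩ F) hDm,
        Set.inter_right_comm, Set.inter_eq_self_of_subset_right hDW, Set.inter_sdiff_right_comm]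
    have h1 : μ.real ((W \ D) ∩ F) ≤ μ.real (W \ D) := measureReal_mono Set.inter_subset_left
    have h2 : p * μ.real (W \ D) ≤ μ.real (W \ D) :=
      mul_le_of_le_one_left measureReal_nonneg hp1
    have h3 : 0 ≤ p * μ.real (W \ D) := mul_nonneg hp0 measureReal_nonneg
    have h4 : 0 ≤ μ.real ((W \ D) ∩ F) := measureReal_nonneg
    refine le_trans ?_ hrest
    rw [hsplit1, hsplit2, hDF, abs_le]
    constructor <;> linarith
  have hlim : Tendsto (fun M : ℕ => (n * ((t - s : ℝ≥0) : ℝ) ^ 2) / ((M : ℝ) + 1)) atTop (𝓝 0) :=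
    tendsto_const_nhds.div_atTop (tendsto_natCast_atTop_atTop.atTop_add tendsto_const_nhds)
  have h0 := ge_of_tendsto' hlim key
  exact sub_eq_zero.1 (abs_nonpos_iff.1 h0)

end IsSingleSiteChain

/-! ### Induction over the windows. -/

/-- In `[s, t]` site `a` flips exactly once and site `b` does not flip. -/
def flipWindow {n : ℕ} {Ω : Type*} (X : ℝ≥0 → Ω → Config n) (a b : Fin n) (s t : ℝ≥0) : Set Ω :=
  {ω | (flipTimes X a ω ∩ Set.Icc s t).encard = 1 ∧ (flipTimes X b ω ∩ Set.Icc s t).encard = 0}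

namespace IsSingleSiteChain

variable {n : ℕ} {Ω : Type*} [mΩ : MeasurableSpace Ω] {μ : Measure Ω}
  {P : Fin n → Config n → Config n → ℝ} {T : ℝ≥0}
  {X : ℝ≥0 → Ω → Config n} {U : Fin n → Ω → Set ℝ≥0}

lemma encard_flipTimes_of_notMem (hX : IsSingleSiteChain μ P T X U) {q : Fin n} {ω : Ω}
    {s t : ℝ≥0} (hst : s ≤ t) (htT : t ≤ T) (hs : s ∉ U q ω) :
    (flipTimes X q ω ∩ Set.Icc s t).encard = (flipTimes X q ω ∩ Set.Ioc s t).ncard := by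
  classical
  rw [hX.encard_flipTimes_Icc q ω hst htT,
    if_neg fun h => hs (hX.mem_of_mem_flipTimes (hst.trans htT) h), add_zero]

lemma someUpdate_of_flipWindow (hX : IsSingleSiteChain μ P T X U) {a b : Fin n} {ω : Ω}
    {s t : ℝ≥0} (hst : s ≤ t) (htT : t ≤ T) (hs : s ∉ U a ω) (hω : ω ∈ flipWindow X a b s t) :
    ω ∈ someUpdate U a s t := by
  intro h0
  have h1 := hω.1
  rw [hX.encard_flipTimes_of_notMem hst htT hs, hX.flipTimes_Ioc_of_no_update htT
    ((Set.ncard_eq_zero (hX.finite_Ioc a ω s htT)).1 h0)] at h1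
  simp at h1

/-- Site `b` has no update, hence no flip, and `a` has a single update, so it flips once or never
according to its spins at the endpoints. -/
lemma flipWindow_iff_of_soleUpdate (hX : IsSingleSiteChain μ P T X U) {S : Finset (Fin n)}
    {a b : Fin n} {ω : Ω} {s t : ℝ≥0} (hst : s ≤ t) (htT : t ≤ T) (hsa : s ∉ U a ω)
    (hsb : s ∉ U b ω) (hb : b ∈ S) (hba : b ≠ a) (hω : ω ∈ soleUpdate U S a s t) :
    ω ∈ flipWindow X a b s t ↔ X t ω a ≠ X s ω a := by
  rw [flipWindow, Set.mem_ofPred_eq, hX.encard_flipTimes_of_notMem hst htT hsa,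
    hX.encard_flipTimes_of_notMem hst htT hsb, hX.ncard_flipTimes_of_le_one hst htT hω.1.le,
    hX.flipTimes_Ioc_of_no_update htT
      ((Set.ncard_eq_zero (hX.finite_Ioc b ω s htT)).1 (hω.2 b hb hba))]
  split_ifs with h <;> simp [h]

/-- The event `flipEvent X i j l ε s` requires an update in each of its windows. -/
lemma measureReal_inter_flipEvent_le [IsProbabilityMeasure μ] (hX : IsSingleSiteChain μ P T X U)
    (i j : Fin n) (ε : ℝ≥0) (l : List (Fin n)) :
    ∀ (s : ℝ≥0), s + l.length * ε ≤ T → ∀ B : Set Ω, MeasurableSet[fullHistory X U s] B →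
      μ.real (B ∩ flipEvent X i j l ε s) ≤ (1 - Real.exp (-ε)) ^ l.length * μ.real B := by
  induction l with
  | nil =>
    intro s _ B _
    simpa using measureReal_mono Set.inter_subset_left
  | cons a l ih =>
    intro s hs B hB
    have hlen : s + ε + l.length * ε ≤ T := by
      refine le_trans (le_of_eq ?_) hs
      push_cast [List.length_cons]
      ring
    have hsT : s + ε ≤ T := le_self_add.trans hlen
    have hle : s ≤ s + ε := le_self_add
    have hV := measurableSet_someUpdate (U := U) (s := s) (t := s + ε) a
    -- The inclusion is only almost sure: a flip at time `s` itself would satisfy the closed window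
    -- without an update in `(s, s + ε]`.
    have hae : (B ∩ flipEvent X i j (a :: l) ε s : Set Ω) ≤ᵐ[μ]
        (B ∩ someUpdate U a s (s + ε) ∩ flipEvent X i j l ε (s + ε) : Set Ω) := by
      filter_upwards [hX.ae_notMem_update (hle.trans hsT) a] with ω hωa hω
      have hω' : ω ∈ B ∩ flipEvent X i j (a :: l) ε s := hω
      rw [flipEvent_cons] at hω'
      exact ⟨⟨hω'.1, hX.someUpdate_of_flipWindow hle hsT hωa hω'.2.1⟩, hω'.2.2⟩
    have hmono : μ.real (B ∩ flipEvent X i j (a :: l) ε s) ≤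
        μ.real (B ∩ someUpdate U a s (s + ε) ∩ flipEvent X i j l ε (s + ε)) :=
      ENNReal.toReal_mono (measure_ne_top _ _) (measure_mono_ae hae)
    refine hmono.trans ((ih (s + ε) hlen _ ((fullHistory_mono X U hle _ hB).inter
      (hX.incrementHistory_le_fullHistory hle hsT _ hV))).trans_eq ?_)
    rw [hX.measureReal_inter hle hsT hB hV, hX.measureReal_someUpdate hle hsT,
      add_tsub_cancel_left, List.length_cons]
    ring

/-- Two-sided estimate of the probability of `flipEvent X i j l ε s` given the past, for a set
`S` of sites whose spins determine the flip probabilities of the sites `i` and `j`. -/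
lemma measureReal_inter_flipEvent_mem_Icc [IsProbabilityMeasure μ]
    (hX : IsSingleSiteChain μ P T X U) (hP : IsSiteKernel P) {i j : Fin n} (hij : i ≠ j)
    {S : Finset (Fin n)} (hi : i ∈ S) (hj : j ∈ S)
    (hloc : ∀ a, a = i ∨ a = j → ∀ x y : Config n, (∀ q ∈ S, x q = y q) →
      P a x (x.flip {a}) = P a y (y.flip {a}))
    (ε : ℝ≥0) {c : ℝ} (hc : c = ε * Real.exp (-(S.card * ε))) (l : List (Fin n)) :
    (∀ a ∈ l, a = i ∨ a = j) → ∀ (s : ℝ≥0), s + l.length * ε ≤ T → ∀ (x : Config n)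
      (B : Set Ω), MeasurableSet[fullHistory X U s] B → (∀ ω ∈ B, ∀ q ∈ S, X s ω q = x q) →
      μ.real (B ∩ flipEvent X i j l ε s) ∈ Set.Icc (c ^ l.length * transitionProd P l x * μ.real B)
        ((c ^ l.length * transitionProd P l x +
          ((1 - Real.exp (-ε)) ^ l.length - c ^ l.length)) * μ.real B) := by
  induction l with
  | nil =>
    intro _ s _ x B _ _
    have h : flipEvent X i j [] ε s = Set.univ := Set.eq_univ_of_forall fun ω k => k.elim0
    simp [transitionProd_nil, h]
  | cons a l ih =>
    intro hl s hs x B hB hBx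
    have ha := hl a List.mem_cons_self
    have haS : a ∈ S := ha.elim (· ▸ hi) (· ▸ hj)
    obtain ⟨b, hb⟩ : ∃ b, b = if a = i then j else i := ⟨_, rfl⟩
    have hbS : b ∈ S := by
      rw [hb]
      split_ifs
      exacts [hj, hi]
    have hba : b ≠ a := by
      rw [hb]
      split_ifs with h
      exacts [h ▸ hij.symm, fun h' => h h'.symm]
    have hlen : s + ε + l.length * ε ≤ T := by
      refine le_trans (le_of_eq ?_) hs
      push_cast [List.length_cons]
      ring
    have hsT : s + ε ≤ T := le_self_add.trans hlen
    have hle : s ≤ s + ε := le_self_add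
    have hVi := measurableSet_someUpdate (U := U) (s := s) (t := s + ε) a
    have hWi := measurableSet_soleUpdate (U := U) (s := s) (t := s + ε) S a
    have hincr := hX.incrementHistory_le_fullHistory hle hsT
    have hB' := fullHistory_mono X U hle _ hB
    set W := soleUpdate U S a s (s + ε) with hW
    set V := someUpdate U a s (s + ε) with hV
    set F := {ω | X (s + ε) ω a ≠ X s ω a} with hF
    set E := flipEvent X i j l ε (s + ε) with hE
    set p := P a x (x.flip {a}) with hp
    set q := 1 - Real.exp (-(ε : ℝ)) with hq
    have hWV : W ⊆ V := soleUpdate_subset_someUpdate S a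
    have hμW : μ.real W = c := by
      rw [hX.measureReal_soleUpdate hle hsT haS, hc, add_tsub_cancel_left]
    have hμV : μ.real V = q := by
      rw [hX.measureReal_someUpdate hle hsT, add_tsub_cancel_left]
    have hc0 : 0 ≤ c := hμW ▸ measureReal_nonneg
    have hcq : c ≤ q := hμW ▸ hμV ▸ measureReal_mono hWV
    have hp0 : 0 ≤ p := hP.nonneg _ _ _
    have hp1 : p ≤ 1 := hP.le_one _ _ _
    have hB1 : MeasurableSet[fullHistory X U (s + ε)] (B ∩ W ∩ F) :=
      (hB'.inter (hincr _ hWi)).inter (measurableSet_spin_ne X U hle a)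
    have hB2 : MeasurableSet[fullHistory X U (s + ε)] (B ∩ (V \ W)) :=
      hB'.inter ((hincr _ hVi).diff (hincr _ hWi))
    have hμ1 : μ.real (B ∩ W ∩ F) = p * (μ.real B * c) := by
      rw [hX.measureReal_flip_of_soleUpdate haS hp0 hp1
        (fun z hz => hloc a ha z x hz) hle hsT hB hBx, hX.measureReal_inter hle hsT hB hWi, hμW]
    have hμ2 : μ.real (B ∩ (V \ W)) = μ.real B * (q - c) := by
      rw [hX.measureReal_inter hle hsT hB (hVi.diff hWi),
        measureReal_sdiff hWV (hX.incrementHistory_le hle hsT _ hWi), hμV, hμW]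
    -- After a good window with a flip, the spins on `S` are again deterministic, so the induction
    -- hypothesis applies with `x.flip {a}`.
    have hB1x : ∀ ω ∈ B ∩ W ∩ F, ∀ k ∈ S, X (s + ε) ω k = x.flip {a} k := by
      rintro ω ⟨⟨hωB, hωW⟩, hωF⟩ k hk
      rcases eq_or_ne k a with rfl | hka
      · rw [Config.flip_singleton_apply_self, ← hBx ω hωB k hk]
        exact Int.units_ne_iff_eq_neg.1 hωF
      · rw [Config.flip_singleton_apply_of_ne _ hka, ← hBx ω hωB k hk]
        exact hX.spin_eq_of_ncard hle hsT (hωW.2 k hk hka)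
    obtain ⟨hlow, hupp⟩ := ih (fun a' ha' => hl a' (List.mem_cons_of_mem a ha')) (s + ε) hlen
      (x.flip {a}) (B ∩ W ∩ F) hB1 hB1x
    have hupp2 := hX.measureReal_inter_flipEvent_le i j ε l (s + ε) hlen _ hB2
    have hs_a := hX.ae_notMem_update (hle.trans hsT) a
    have hs_b := hX.ae_notMem_update (hle.trans hsT) b
    have hcons : flipEvent X i j (a :: l) ε s = flipWindow X a b s (s + ε) ∩ E := by
      rw [flipEvent_cons, hb]
      rfl
    have hsub1 : μ.real (B ∩ W ∩ F ∩ E) ≤ μ.real (B ∩ flipEvent X i j (a :: l) ε s) := by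
      refine ENNReal.toReal_mono (measure_ne_top _ _) (measure_mono_ae ?_)
      filter_upwards [hs_a, hs_b] with ω h1 h2 hω
      have hω' : ω ∈ B ∩ W ∩ F ∩ E := hω
      change ω ∈ B ∩ flipEvent X i j (a :: l) ε s
      rw [hcons]
      exact ⟨hω'.1.1.1, (hX.flipWindow_iff_of_soleUpdate hle hsT h1 h2 hbS hba hω'.1.1.2).2
        hω'.1.2, hω'.2⟩
    -- A good window leads to the induction hypothesis; a bad one still needs an update of `a`, and
    -- the later windows are then bounded crudely by `measureReal_inter_flipEvent_le`.
    have hsub2 : μ.real (B ∩ flipEvent X i j (a :: l) ε s) ≤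
        μ.real (B ∩ W ∩ F ∩ E ∪ B ∩ (V \ W) ∩ E) := by
      refine ENNReal.toReal_mono (measure_ne_top _ _) (measure_mono_ae ?_)
      filter_upwards [hs_a, hs_b] with ω h1 h2 hω
      have hω' : ω ∈ B ∩ flipEvent X i j (a :: l) ε s := hω
      rw [hcons] at hω'
      by_cases hωW : ω ∈ W
      · exact Or.inl ⟨⟨⟨hω'.1, hωW⟩,
          (hX.flipWindow_iff_of_soleUpdate hle hsT h1 h2 hbS hba hωW).1 hω'.2.1⟩, hω'.2.2⟩
      · exact Or.inr ⟨⟨hω'.1, hX.someUpdate_of_flipWindow hle hsT h1 hω'.2.1, hωW⟩, hω'.2.2⟩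
    have hunion := measureReal_union_le (μ := μ) (B ∩ W ∩ F ∩ E) (B ∩ (V \ W) ∩ E)
    rw [hμ1] at hlow hupp
    rw [hμ2] at hupp2
    have hβ : 0 ≤ μ.real B := measureReal_nonneg
    rw [transitionProd_cons, ← hp, List.length_cons]
    generalize μ.real B = β at *
    generalize transitionProd P l (x.flip {a}) = ϖ at *
    generalize l.length = m at *
    constructor
    · refine le_trans (le_of_eq ?_) (hlow.trans hsub1)
      ring
    · refine hsub2.trans (hunion.trans ((add_le_add hupp hupp2).trans ?_))
      have hpow : 0 ≤ q ^ m - c ^ m := sub_nonneg.2 (pow_le_pow_left₀ hc0 hcq m)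
      -- After `p` is dropped from the error, the errors telescope: `c * (q ^ m - c ^ m) + q ^ m *
      -- (q - c) = q ^ (m + 1) - c ^ (m + 1)`.
      have h1 : (q ^ m - c ^ m) * (p * (β * c)) ≤ (q ^ m - c ^ m) * (β * c) :=
        mul_le_mul_of_nonneg_left (mul_le_of_le_one_left (mul_nonneg hβ hc0) hp1) hpow
      rw [pow_succ, pow_succ]
      linarith

end IsSingleSiteChain

/-! ### From estimates on events to conditional probabilities. -/

/-- Restricting the measure to `m` makes comparison on sets of `m` alone sufficient for functions
measurable with respect to `m`. -/
lemma ae_le_of_forall_setIntegral_le_of_stronglyMeasurable {Ω : Type*} {m mΩ : MeasurableSpace Ω}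
    {μ : Measure Ω} [IsFiniteMeasure μ] (hm : m ≤ mΩ) {f g : Ω → ℝ}
    (hf : StronglyMeasurable[m] f) (hg : StronglyMeasurable[m] g)
    (hfi : Integrable f μ) (hgi : Integrable g μ)
    (h : ∀ s, MeasurableSet[m] s → ∫ ω in s, f ω ∂μ ≤ ∫ ω in s, g ω ∂μ) : f ≤ᵐ[μ] g := by
  refine ae_le_of_ae_le_trim (hm := hm) ?_
  refine ae_le_of_forall_setIntegral_le (hfi.trim hm hf) (hgi.trim hm hg) fun s hs _ => ?_
  rw [← setIntegral_trim hm hf hs, ← setIntegral_trim hm hg hs]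
  exact h s hs

/-- Linearise the exponential: `exp (-(N * ε * m)) ≥ 1 - N * ε * m`. -/
lemma pow_sub_pow_le {ε N : ℝ} (hε : 0 ≤ ε) (m : ℕ) :
    ε ^ m - (ε * Real.exp (-(N * ε))) ^ m ≤ N * m * ε ^ (m + 1) := by
  have h : 1 - N * ε * m ≤ Real.exp (-(N * ε)) ^ m := by
    rw [← Real.exp_nat_mul]
    refine le_trans (le_of_eq ?_) (Real.add_one_le_exp _)
    ring
  have h2 := mul_le_mul_of_nonneg_left h (pow_nonneg hε m)
  rw [mul_pow, pow_succ]
  linarith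

/-- A conditional probability is pinned by two-sided bounds on the level sets of a
finitely valued random variable. -/
lemma abs_condExp_indicator_sub_le {Ω β : Type*} [Fintype β] {m mΩ : MeasurableSpace Ω}
    {μ : Measure Ω} [IsFiniteMeasure μ] (hm : m ≤ mΩ) {E : Set Ω} (hE : MeasurableSet[mΩ] E)
    {Y : Ω → β} (hY : Measurable[m, ⊤] Y) (g : β → ℝ) (K : ℝ)
    (h : ∀ y F, MeasurableSet[m] F → (∀ ω ∈ F, Y ω = y) →
      μ.real (F ∩ E) ∈ Set.Icc ((g y - K) * μ.real F) ((g y + K) * μ.real F)) :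
    ∀ᵐ ω ∂μ, |(μ⟦E | m⟧) ω - g (Y ω)| ≤ K := by
  have hcomp : ∀ G : β → ℝ, StronglyMeasurable[m] fun ω => G (Y ω) := fun G =>
    ((measurable_from_top (f := G)).comp hY).stronglyMeasurable
  have hint : ∀ G : β → ℝ, Integrable (fun ω => G (Y ω)) μ := by
    intro G
    obtain ⟨C, hC⟩ := (Set.finite_range fun y => ‖G y‖).bddAbove
    exact Integrable.of_bound ((hcomp G).mono hm).aestronglyMeasurable C
      (Eventually.of_forall fun ω => hC ⟨Y ω, rfl⟩)
  have hcm : StronglyMeasurable[m] (μ⟦E | m⟧) := stronglyMeasurable_condExp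
  have hci : Integrable (μ⟦E | m⟧) μ := integrable_condExp
  have hlevel : ∀ y, MeasurableSet[m] (Y ⁻¹' {y}) := fun y => hY MeasurableSpace.measurableSet_top
  -- The hypothesis concerns only sets on which `Y` is constant, so every integral is cut along the
  -- finitely many values of `Y`.
  have hsplit : ∀ (f : Ω → ℝ), Integrable f μ → ∀ s, MeasurableSet[m] s →
      ∫ ω in s, f ω ∂μ = ∑ y, ∫ ω in s ∩ Y ⁻¹' {y}, f ω ∂μ := by
    intro f hf s hs
    rw [← integral_iUnion_fintype]
    · congr 2
      ext ω
      simp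
    · exact fun y => hm _ (hs.inter (hlevel y))
    · intro y y' hyy'
      exact Set.disjoint_left.2 fun ω h1 h2 => hyy' (h1.2.symm.trans h2.2)
    · exact fun y => hf.integrableOn
  have hE' : ∀ s, MeasurableSet[m] s → ∫ ω in s, (μ⟦E | m⟧) ω ∂μ = μ.real (s ∩ E) := by
    intro s hs
    rw [setIntegral_condExp hm ((integrable_const (1 : ℝ)).indicator hE) hs,
      integral_indicator_const _ hE, smul_eq_mul, mul_one, measureReal_restrict_apply hE,
      Set.inter_comm]
  have hG : ∀ (G : β → ℝ) (s : Set Ω), MeasurableSet[m] s → ∀ y,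
      ∫ ω in s ∩ Y ⁻¹' {y}, G (Y ω) ∂μ = G y * μ.real (s ∩ Y ⁻¹' {y}) := by
    intro G s hs y
    rw [setIntegral_congr_fun (g := fun _ => G y) (hm _ (hs.inter (hlevel y)))
      fun ω hω => congrArg G hω.2, setIntegral_const, smul_eq_mul, mul_comm]
  have hlow : (fun ω => g (Y ω) - K) ≤ᵐ[μ] μ⟦E | m⟧ := by
    refine ae_le_of_forall_setIntegral_le_of_stronglyMeasurable hm (hcomp fun y => g y - K) hcm
      (hint fun y => g y - K) hci fun s hs => ?_
    rw [hsplit _ (hint fun y => g y - K) s hs, hsplit _ hci s hs]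
    refine Finset.sum_le_sum fun y _ => ?_
    rw [hG (fun y => g y - K) s hs, hE' _ (hs.inter (hlevel y))]
    exact (h y _ (hs.inter (hlevel y)) fun ω hω => hω.2).1
  have hupp : μ⟦E | m⟧ ≤ᵐ[μ] fun ω => g (Y ω) + K := by
    refine ae_le_of_forall_setIntegral_le_of_stronglyMeasurable hm hcm (hcomp fun y => g y + K) hci
      (hint fun y => g y + K) fun s hs => ?_
    rw [hsplit _ (hint fun y => g y + K) s hs, hsplit _ hci s hs]
    refine Finset.sum_le_sum fun y _ => ?_
    rw [hG (fun y => g y + K) s hs, hE' _ (hs.inter (hlevel y))]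
    exact (h y _ (hs.inter (hlevel y)) fun ω hω => hω.2).2
  filter_upwards [hlow, hupp] with ω h1 h2
  exact abs_le.2 ⟨by linarith, by linarith⟩

/-- The two measurability conclusions guarantee that the conditional probability is not the default
value `0` of the conditional expectation. -/
theorem mainTheorem4 :
    ∃ C : ℝ, 0 < C ∧
      ∀ (n d : ℕ) (A : Matrix (Fin n) (Fin n) ℝ) (h : Fin n → ℝ)
        (P : Fin n → Config n → Config n → ℝ),
        0 < d → A.IsSymm → DegreeAtMost A d →
        IsSiteKernel P → IsReversible (isingProb A h) P → IsSiteConsistent (isingProb A h) P →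
      ∀ (Ω : Type*) [mΩ : MeasurableSpace Ω] (μ : Measure Ω) [IsProbabilityMeasure μ]
        (T : ℝ≥0) (X : ℝ≥0 → Ω → Config n) (U : Fin n → Ω → Set ℝ≥0),
        IsSingleSiteChain μ P T X U →
      ∀ (i j : Fin n) (l : List (Fin n)) (t ε : ℝ≥0),
        i ≠ j → (∀ a ∈ l, a = i ∨ a = j) → 0 < t → 0 < ε →
        C * l.length * ε < 1 → t + l.length * ε ≤ T →
        obsHistory X t ≤ mΩ ∧ MeasurableSet (flipEvent X i j l ε t) ∧
        ∀ᵐ ω ∂μ,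
          |(μ⟦flipEvent X i j l ε t | obsHistory X t⟧) ω
              - (ε : ℝ) ^ l.length * transitionProd P l (X t ω)|
            ≤ C * l.length * d * (ε : ℝ) ^ (l.length + 1) := by
  -- The constant comes from `S.card ≤ 2 + 2 * d ≤ 4 * d`, where the last step needs `d ≥ 1`.
  refine ⟨4, by norm_num, ?_⟩
  intro n d A h P hd hA hdeg hP hrev hcons Ω mΩ μ _ T X U hX i j l t ε hij hl _ _ _ htT
  have ht : t ≤ T := le_self_add.trans htT
  have hmeas := hX.measurableSet_flipEvent i j l ε t htT
  refine ⟨hX.obsHistory_le ht, hmeas, ?_⟩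
  set S : Finset (Fin n) := {i, j} ∪ (neighbors A i ∪ neighbors A j) with hS
  have hi : i ∈ S := by simp [hS]
  have hj : j ∈ S := by simp [hS]
  have hnbr : ∀ a, a = i ∨ a = j → neighbors A a ⊆ S := by
    rintro a (rfl | rfl) k hk <;> simp [hS, hk]
  have hcard : (S.card : ℝ) ≤ 4 * d := by
    have h1 := card_neighbors_le hdeg i
    have h2 := card_neighbors_le hdeg j
    have h3 := Finset.card_union_le (neighbors A i) (neighbors A j)
    have h4 := Finset.card_union_le {i, j} (neighbors A i ∪ neighbors A j)
    have h5 := Finset.card_le_two (a := i) (b := j)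
    have h6 : S.card ≤ 4 * d := by
      rw [hS]
      omega
    exact_mod_cast h6
  have hloc : ∀ a, a = i ∨ a = j → ∀ x y : Config n, (∀ q ∈ S, x q = y q) →
      P a x (x.flip {a}) = P a y (y.flip {a}) := fun a ha x y hxy =>
    kernel_flip_congr hA hrev hcons (hxy a (ha.elim (· ▸ hi) (· ▸ hj)))
      fun k hk => hxy k (hnbr a ha hk)
  refine abs_condExp_indicator_sub_le (hX.obsHistory_le ht) hmeas (hX.measurable_obsHistory ht)
    (fun x => (ε : ℝ) ^ l.length * transitionProd P l x) _ fun x F hF hFx => ?_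
  obtain ⟨hlow, hupp⟩ := hX.measureReal_inter_flipEvent_mem_Icc hP hij hi hj hloc ε rfl l hl t htT
    x F (((hX.obsHistory_le_pathHistory ht).trans le_sup_left) _ hF)
    fun ω hω q _ => by rw [hFx ω hω]
  have hε0 : (0 : ℝ) ≤ ε := ε.2
  have herr := pow_sub_pow_le (N := S.card) hε0 l.length
  have herr' : (S.card : ℝ) * l.length * (ε : ℝ) ^ (l.length + 1) ≤
      4 * l.length * d * (ε : ℝ) ^ (l.length + 1) := by
    refine mul_le_mul_of_nonneg_right ?_ (pow_nonneg hε0 _)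
    calc (S.card : ℝ) * l.length ≤ 4 * d * l.length :=
          mul_le_mul_of_nonneg_right hcard (Nat.cast_nonneg _)
      _ = 4 * l.length * d := by ring
  have hq : (1 - Real.exp (-(ε : ℝ))) ^ l.length ≤ (ε : ℝ) ^ l.length := by
    refine pow_le_pow_left₀ (sub_nonneg.2 (Real.exp_le_one_iff.2 (neg_nonpos.2 hε0))) ?_ _
    linarith [Real.one_sub_le_exp_neg (ε : ℝ)]
  have hc : ((ε : ℝ) * Real.exp (-(S.card * ε))) ^ l.length ≤ (ε : ℝ) ^ l.length := by
    refine pow_le_pow_left₀ (by positivity) (mul_le_of_le_one_right hε0 ?_) _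
    exact Real.exp_le_one_iff.2 (neg_nonpos.2 (by positivity))
  have hprod0 := transitionProd_nonneg hP l x
  have hprod1 := transitionProd_le_one hP l x
  generalize transitionProd P l x = ϖ at *
  generalize ((ε : ℝ) * Real.exp (-(S.card * ε))) ^ l.length = c at *
  -- Here `c` already denotes the power. Since `0 ≤ ϖ ≤ 1`, replacing `c * ϖ` by `ε ^ l.length * ϖ`
  -- costs at most `ε ^ l.length - c`, which `herr` bounds.
  have h1 := mul_le_mul_of_nonneg_right hc hprod0
  have h2 := mul_le_mul_of_nonneg_left hprod1 (sub_nonneg.2 hc)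
  constructor
  · refine le_trans (mul_le_mul_of_nonneg_right ?_ measureReal_nonneg) hlow
    linarith
  · refine hupp.trans (mul_le_mul_of_nonneg_right ?_ measureReal_nonneg)
    linarith
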